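/- Let $G$ be a hyperbolic TDLC group, that is, a compactly generated, totally disconnected, locally compact Hausdorff topological group that has some Gromov hyperbolic Cayley–Abels graph. Here a Cayley–Abels graph of $G$ is a locally finite connected graph on which $G$ acts by automorphisms, vertex transitively, with compact open vertex stabilizers, and it is Gromov hyperbolic if, for some $\delta\ge 0$, all its geodesic triangles are $\delta$-slim. Let $X$ be any Cayley–Abels graph of $G$, let $x_0$ be a vertex of $X$, and let $\partial X$ be the Gromov boundary of $X$, that is, the set of geodesic rays in $X$ up to finite Hausdorff distance, with the quotient topology from the space of geodesic rays starting at $x_0$ (with the topology of uniform convergence on compact sets). Let $G$ act on $\partial X$ by $g\cdot[\gamma]=[g\gamma]$. Then $G$ acts on $\partial X$ as a uniform convergence group: $\partial X$ is a compact Hausdorff space, the action $G\times\partial X\to\partial X$ is continuous, and the induced action of $G$ on the space $\theta(\partial X)$ of unordered triples of pairwise distinct points of $\partial X$ (with the quotient topology from the subspace of distinct triples in $(\partial X)^3$) is 1. proper: for every compact set $K\subseteq\theta(\partial X)$ the set $\{g\in G : gK\cap K\neq\emptyset\}$ has compact closure in $G$; and 2. cocompact: there is a compact set $K\subseteq\theta(\partial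 X)$ with $\bigcup_{g\in G} gK=\theta(\partial X)$. -/

import Mathlib

open Set
open scoped Pointwise

universe u v

namespace TDLC

/-! ### Isometric actions on graphs

A graph is regarded as a metric space through the path metric of its vertex set. Geodesic segments
and geodesic rays issuing from a vertex are edge paths, so they are given by sequences of vertices.
-/

section Graphs

variable {V : Type v}

/-- `G` acts on the graph `X` by graph automorphisms. -/
class IsGraphAction (G : Type u) [Group G] [MulAction G V] (X : SimpleGraph V) : Prop where
  adj_smul : ∀ (g : G) (a b : V), X.Adj a b → X.Adj (g • a) (g • b)

theorem edist_smul_le {G : Type u} [Group G] [MulAction G V] (X : SimpleGraph V)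
    [IsGraphAction G X] (g : G) (a b : V) : X.edist (g • a) (g • b) ≤ X.edist a b := by
  let f : X →g X := ⟨fun a => g • a, fun {a b} h => IsGraphAction.adj_smul g a b h⟩
  refine le_iInf fun w => ?_
  have h := SimpleGraph.edist_le (w.map f)
  rw [SimpleGraph.Walk.length_map] at h
  exact h

theorem edist_smul {G : Type u} [Group G] [MulAction G V] (X : SimpleGraph V)
    [IsGraphAction G X] (g : G) (a b : V) : X.edist (g • a) (g • b) = X.edist a b := by
  refine le_antisymm (edist_smul_le X g a b) ?_
  simpa using edist_smul_le X g⁻¹ (g • a) (g • b)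

/-- Gromov hyperbolicity of a graph: geodesic triangles are uniformly slim, that is, for some `δ`
every vertex on a side of a geodesic triangle is within distance `δ` of the union of the other two
sides. -/
def IsGromovHyperbolic (X : SimpleGraph V) : Prop :=
  ∃ δ : ℕ, ∀ (x y z : V) (p : X.Walk x y) (q : X.Walk y z) (r : X.Walk z x),
    p.length = X.dist x y → q.length = X.dist y z → r.length = X.dist z x →
      ∀ a ∈ p.support, ∃ b, (b ∈ q.support ∨ b ∈ r.support) ∧ X.dist a b ≤ δ

/-- A geodesic ray: an isometric embedding of `ℕ` in the vertex set. -/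
@[ext]
structure GeodesicRay (X : SimpleGraph V) where
  toFun : ℕ → V
  edist_eq : ∀ m n : ℕ, X.edist (toFun m) (toFun (m + n)) = n

namespace GeodesicRay

variable {X : SimpleGraph V}

/-- The Hausdorff distance of (the images of) two rays is finite. -/
def Asymptotic (α β : GeodesicRay X) : Prop :=
  ∃ C : ℕ, (∀ m, ∃ n, X.edist (α.toFun m) (β.toFun n) ≤ C) ∧
    (∀ n, ∃ m, X.edist (β.toFun n) (α.toFun m) ≤ C)

theorem asymptotic_refl (α : GeodesicRay X) : Asymptotic α α :=
  ⟨0, fun m => ⟨m, by simp⟩, fun m => ⟨m, by simp⟩⟩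

theorem Asymptotic.symm {α β : GeodesicRay X} (h : Asymptotic α β) : Asymptotic β α := by
  obtain ⟨C, h₁, h₂⟩ := h
  exact ⟨C, h₂, h₁⟩

theorem Asymptotic.trans {α β γ : GeodesicRay X} (h : Asymptotic α β) (k : Asymptotic β γ) :
    Asymptotic α γ := by
  obtain ⟨C, h₁, h₂⟩ := h
  obtain ⟨D, k₁, k₂⟩ := k
  refine ⟨C + D, fun m => ?_, fun m => ?_⟩
  · obtain ⟨n, hn⟩ := h₁ m
    obtain ⟨l, hl⟩ := k₁ n
    refine ⟨l, (X.edist_triangle (v := β.toFun n)).trans ?_⟩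
    push_cast
    exact add_le_add hn hl
  · obtain ⟨n, hn⟩ := k₂ m
    obtain ⟨l, hl⟩ := h₂ n
    refine ⟨l, (X.edist_triangle (v := β.toFun n)).trans ?_⟩
    push_cast
    rw [add_comm (C : ℕ∞)]
    exact add_le_add hn hl

/-- Rays carry the topology of pointwise convergence, the vertex set being discrete. (For the
corresponding paths in the geometric realization this is uniform convergence on compact sets.) -/
instance : TopologicalSpace (GeodesicRay X) :=
  TopologicalSpace.induced GeodesicRay.toFun
    (@Pi.topologicalSpace ℕ (fun _ => V) (fun _ => ⊥))

instance (G : Type u) [Group G] [MulAction G V] [IsGraphAction G X] :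
    MulAction G (GeodesicRay X) where
  smul g α := ⟨fun n => g • α.toFun n, fun m n => by rw [edist_smul, α.edist_eq]⟩
  one_smul α := GeodesicRay.ext (funext fun n => one_smul G (α.toFun n))
  mul_smul g h α := GeodesicRay.ext (funext fun n => mul_smul g h (α.toFun n))

theorem smul_toFun {G : Type u} [Group G] [MulAction G V] [IsGraphAction G X] (g : G)
    (α : GeodesicRay X) (n : ℕ) : (g • α).toFun n = g • α.toFun n := rfl

theorem Asymptotic.smul {G : Type u} [Group G] [MulAction G V] [IsGraphAction G X] (g : G)
    {α β : GeodesicRay X} (h : Asymptotic α β) : Asymptotic (g • α) (g • β) := by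
  obtain ⟨C, h₁, h₂⟩ := h
  exact ⟨C, by simpa only [smul_toFun, edist_smul] using h₁,
    by simpa only [smul_toFun, edist_smul] using h₂⟩

instance asymptoticSetoid (X : SimpleGraph V) : Setoid (GeodesicRay X) where
  r := Asymptotic
  iseqv := ⟨asymptotic_refl, Asymptotic.symm, Asymptotic.trans⟩

end GeodesicRay

/-- The Gromov boundary of a graph `X`: the set of geodesic rays modulo finite Hausdorff distance.
The base vertex `x₀` is used for the topology only. In a locally finite connected hyperbolic graph
every class contains a ray that starts at `x₀`, so the points are the classes of such rays. -/
def GromovBoundary (X : SimpleGraph V) (_x₀ : V) : Type v :=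
  Quotient (GeodesicRay.asymptoticSetoid X)

namespace GromovBoundary

variable {X : SimpleGraph V}

/-- The boundary point of a ray. -/
def mk (x₀ : V) (α : GeodesicRay X) : GromovBoundary X x₀ :=
  Quotient.mk (GeodesicRay.asymptoticSetoid X) α

/-- The quotient topology from the space of the geodesic rays that start at `x₀`. -/
instance (x₀ : V) : TopologicalSpace (GromovBoundary X x₀) :=
  TopologicalSpace.coinduced
    (fun α : {α : GeodesicRay X // α.toFun 0 = x₀} => mk x₀ α.1) inferInstance

/-- The induced action on the boundary, `g • [α] = [g • α]`. -/
instance (x₀ : V) (G : Type u) [Group G] [MulAction G V] [IsGraphAction G X] :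
    MulAction G (GromovBoundary X x₀) where
  smul g := Quotient.map (fun α => g • α) fun _ _ h => h.smul g
  one_smul ξ := Quotient.inductionOn ξ fun α =>
    congrArg (mk x₀) (one_smul G α)
  mul_smul g h ξ := Quotient.inductionOn ξ fun α =>
    congrArg (mk x₀) (mul_smul g h α)

theorem smul_mk (x₀ : V) {G : Type u} [Group G] [MulAction G V] [IsGraphAction G X] (g : G)
    (α : GeodesicRay X) : g • mk x₀ α = mk x₀ (g • α) := rfl

end GromovBoundary

end Graphs

/-! ### Convergence actions -/

section Convergence

/-- Ordered triples of pairwise distinct points, as a subspace of `Z ^ 3`. -/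
abbrev OrderedTriple (Z : Type v) : Type v := {t : Fin 3 → Z // Function.Injective t}

/-- Two ordered triples are identified if they differ by a permutation of the entries. -/
def tripleSetoid (Z : Type v) : Setoid (OrderedTriple Z) where
  r s t := ∃ σ : Equiv.Perm (Fin 3), ∀ i, t.1 i = s.1 (σ i)
  iseqv :=
    { refl := fun _ => ⟨1, fun _ => rfl⟩
      symm := fun {_ _} ⟨σ, h⟩ => ⟨σ⁻¹, fun i => by rw [h]; simp⟩
      trans := fun {_ _ _} ⟨σ, h⟩ ⟨τ, k⟩ => ⟨σ * τ, fun i => by rw [k, h]; rfl⟩ }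

/-- The space `θ(Z)` of unordered triples of pairwise distinct points of `Z`. -/
def DistinctTriples (Z : Type v) : Type v := Quotient (tripleSetoid Z)

instance (Z : Type v) [TopologicalSpace Z] : TopologicalSpace (DistinctTriples Z) :=
  inferInstanceAs (TopologicalSpace (Quotient (tripleSetoid Z)))

instance (G : Type u) [Group G] (Z : Type v) [MulAction G Z] : MulAction G (OrderedTriple Z) where
  smul g t := ⟨fun i => g • t.1 i, (MulAction.injective g).comp t.2⟩
  one_smul t := Subtype.ext (funext fun i => one_smul G (t.1 i))
  mul_smul g h t := Subtype.ext (funext fun i => mul_smul g h (t.1 i))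

/-- The diagonal action on `θ(Z)`, `g • {x, y, z} = {g • x, g • y, g • z}`. -/
instance (G : Type u) [Group G] (Z : Type v) [MulAction G Z] :
    MulAction G (DistinctTriples Z) where
  smul g := Quotient.map (fun t => g • t) fun _ _ ⟨σ, h⟩ =>
    ⟨σ, fun i => congrArg (fun x => g • x) (h i)⟩
  one_smul t := Quotient.inductionOn t fun s =>
    congrArg (Quotient.mk (tripleSetoid Z)) (one_smul G s)
  mul_smul g h t := Quotient.inductionOn t fun s =>
    congrArg (Quotient.mk (tripleSetoid Z)) (mul_smul g h s)

/-- Proper actions: for every compact `K`, the set of `g` with `gK ∩ K ≠ ∅` is relatively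
compact. -/
def IsProperAction (G : Type u) [Group G] [TopologicalSpace G] (Z : Type v) [TopologicalSpace Z]
    [MulAction G Z] : Prop :=
  ∀ K : Set Z, IsCompact K → IsCompact (closure {g : G | ((g • K) ∩ K).Nonempty})

/-- Cocompact actions: the translates of some compact set cover the space. -/
def IsCocompactAction (G : Type u) [Group G] (Z : Type v) [TopologicalSpace Z]
    [MulAction G Z] : Prop :=
  ∃ K : Set Z, IsCompact K ∧ ⋃ g : G, g • K = univ

/-- `G` acts (continuously) on the compact Hausdorff space `Z` as a convergence group: the induced
action on `θ(Z)` is proper. -/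
structure IsConvergenceAction (G : Type u) [Group G] [TopologicalSpace G] (Z : Type v)
    [TopologicalSpace Z] [MulAction G Z] : Prop where
  compactSpace : CompactSpace Z
  t2Space : T2Space Z
  continuousSMul : ContinuousSMul G Z
  isProperAction : IsProperAction G (DistinctTriples Z)

/-- `G` acts on `Z` as a uniform convergence group: moreover, the action on `θ(Z)` is cocompact. -/
structure IsUniformConvergenceAction (G : Type u) [Group G] [TopologicalSpace G] (Z : Type v)
    [TopologicalSpace Z] [MulAction G Z] : Prop extends IsConvergenceAction G Z where
  isCocompactAction : IsCocompactAction G (DistinctTriples Z)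

end Convergence

/-! ### Hyperbolic groups -/

/-- `X` is a Cayley–Abels graph of `G`: a locally finite connected graph on which `G` acts vertex
transitively with compact open vertex stabilizers. -/
class IsCayleyAbelsGraph (G : Type u) [Group G] [TopologicalSpace G] {V : Type v} [MulAction G V]
    (X : SimpleGraph V) : Prop extends IsGraphAction G X where
  connected : X.Connected
  finite_neighborSet : ∀ a : V, (X.neighborSet a).Finite
  isPretransitive : MulAction.IsPretransitive G V
  isCompact_stabilizer : ∀ a : V, IsCompact (MulAction.stabilizer G a : Set G)
  isOpen_stabilizer : ∀ a : V, IsOpen (MulAction.stabilizer G a : Set G)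

/-- `G` is compactly generated. -/
def IsCompactlyGenerated (G : Type u) [Group G] [TopologicalSpace G] : Prop :=
  ∃ K : Set G, IsCompact K ∧ Subgroup.closure K = ⊤

/-- A compactly generated totally disconnected locally compact group is hyperbolic if some
Cayley–Abels graph of it is Gromov hyperbolic. -/
def IsHyperbolicGroup (G : Type u) [Group G] [TopologicalSpace G] : Prop :=
  IsCompactlyGenerated G ∧
    ∃ (V : Type u) (_ : MulAction G V) (X : SimpleGraph V),
      IsCayleyAbelsGraph G X ∧ IsGromovHyperbolic X

end TDLC

/-! Coarse centres of triples carry the proof: such a centre is a vertex from which the rays to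
three given boundary points separate within a bounded time. Every triple of distinct points has a
centre with a uniform time (`FourPoint.exists_ray_center`). By vertex transitivity it can be moved
to `x₀`, which gives cocompactness. Two centres of the same triple are close
(`FourPoint.dist_ray_center_le`). On a compact set `K` of triples, `x₀` is a centre with one time
bound. If `gK` meets `K`, then `x₀` and `g • x₀` are centres of a common triple, so `g` moves `x₀` a
bounded distance. Such `g` form a compact set, because balls are finite and stabilizers compact;
this is properness.

The topology rests on `endpoint_eq_iff`: rays from `x₀` are asymptotic exactly when they stay `2 *
δ`-close at all times, which is a closed condition. As the rays from `x₀` form a compact space, the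
boundary is a quotient of a compact space by a closed relation. Hence it is compact Hausdorff and
the quotient map is proper, and closedness of the graph of the action yields continuity.

All this uses the four point condition for the given `X`, whereas hyperbolicity is assumed for some
Cayley–Abels graph only. Orbit maps make the two graphs quasi-isometric, and stability of
quasi-geodesics carries slim triangles across. -/

namespace TDLC

/-! ### Slim triangles and the four point condition -/

section HyperbolicGraphs

variable {V : Type v}

/-- The vertex `a` lies on a geodesic from `x` to `y`. -/
def Between (X : SimpleGraph V) (x a y : V) : Prop := X.dist x a + X.dist a y = X.dist x y

/-- Slimness of geodesic triangles, in terms of metric intervals. -/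
def SlimIntervals (X : SimpleGraph V) (δ : ℕ) : Prop :=
  ∀ x y z a : V, Between X x a y → ∃ b, (Between X y b z ∨ Between X z b x) ∧ X.dist a b ≤ δ

/-- Gromov's four point condition. -/
def FourPoint (X : SimpleGraph V) (δ : ℕ) : Prop :=
  ∀ x y z w : V, X.dist x y + X.dist z w ≤
    max (X.dist x z + X.dist y w) (X.dist x w + X.dist y z) + δ

theorem Between.symm {X : SimpleGraph V} {x a y : V} (h : Between X x a y) : Between X y a x := by
  unfold Between at *
  rw [X.dist_comm (u := y) (v := a), X.dist_comm (u := a) (v := x), X.dist_comm (u := y) (v := x)]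
  omega

theorem between_of_mem_support {X : SimpleGraph V} (hX : X.Connected) {x y a : V}
    (p : X.Walk x y) (hp : p.length = X.dist x y) (ha : a ∈ p.support) : Between X x a y := by
  classical
  have h₁ := SimpleGraph.dist_le (p.takeUntil a ha)
  have h₂ := SimpleGraph.dist_le (p.dropUntil a ha)
  have h₃ := congrArg SimpleGraph.Walk.length (p.take_spec ha)
  rw [SimpleGraph.Walk.length_append] at h₃
  have h₄ := hX.dist_triangle (u := x) (v := a) (w := y)
  unfold Between
  omega

theorem IsGromovHyperbolic.exists_slimIntervals {X : SimpleGraph V} (hX : X.Connected)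
    (h : IsGromovHyperbolic X) : ∃ δ, SlimIntervals X δ := by
  obtain ⟨δ, h⟩ := h
  refine ⟨δ, fun x y z a ha => ?_⟩
  obtain ⟨p₁, hp₁⟩ := hX.exists_walk_length_eq_dist x a
  obtain ⟨p₂, hp₂⟩ := hX.exists_walk_length_eq_dist a y
  obtain ⟨q, hq⟩ := hX.exists_walk_length_eq_dist y z
  obtain ⟨r, hr⟩ := hX.exists_walk_length_eq_dist z x
  obtain ⟨b, hb, hab⟩ := h x y z (p₁.append p₂) q r
    (by rw [SimpleGraph.Walk.length_append, hp₁, hp₂]; exact ha) hq hr a (by simp)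
  refine ⟨b, ?_, hab⟩
  exact hb.imp (between_of_mem_support hX q hq) (between_of_mem_support hX r hr)

theorem dist_le_mul_of_step_le {X : SimpleGraph V} (hX : X.Connected) {c : ℕ → V} {K n : ℕ}
    (hc : ∀ i < n, X.dist (c i) (c (i + 1)) ≤ K) {i j : ℕ} (hij : i ≤ j) (hj : j ≤ n) :
    X.dist (c i) (c j) ≤ K * (j - i) := by
  induction j, hij using Nat.le_induction with
  | base => simp
  | succ j hij ih =>
    have h₁ := ih (by omega)
    have h₂ := hc j (by omega)
    have h₃ := hX.dist_triangle (u := c i) (v := c j) (w := c (j + 1))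
    rw [Nat.succ_sub hij, Nat.mul_succ]
    omega

theorem Between.exists_geodesic {X : SimpleGraph V} (hX : X.Connected) {x a y : V}
    (ha : Between X x a y) : ∃ c : ℕ → V, c 0 = x ∧ c (X.dist x a) = a ∧ c (X.dist x y) = y ∧
      ∀ i j, i ≤ j → j ≤ X.dist x y → X.dist (c i) (c j) = j - i := by
  obtain ⟨p₁, hp₁⟩ := hX.exists_walk_length_eq_dist x a
  obtain ⟨p₂, hp₂⟩ := hX.exists_walk_length_eq_dist a y
  obtain ⟨p, hp, hpa⟩ : ∃ p : X.Walk x y, p.length = X.dist x y ∧ p.getVert (X.dist x a) = a :=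
    ⟨p₁.append p₂, by rw [SimpleGraph.Walk.length_append, hp₁, hp₂]; exact ha,
      by rw [SimpleGraph.Walk.getVert_append, if_neg (by omega), hp₁]; simp⟩
  have hle : ∀ i j, i ≤ j → j ≤ X.dist x y → X.dist (p.getVert i) (p.getVert j) ≤ j - i := by
    intro i j hij hj
    have := dist_le_mul_of_step_le hX (c := p.getVert) (K := 1) (n := X.dist x y)
      (fun i hi => (SimpleGraph.dist_eq_one_iff_adj.2
        (p.adj_getVert_succ (by omega))).le) hij hj
    omega
  have h0 : p.getVert 0 = x := p.getVert_zero
  have h1 : p.getVert (X.dist x y) = y := by rw [← hp]; exact p.getVert_length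
  refine ⟨p.getVert, h0, hpa, h1, fun i j hij hj => le_antisymm (hle i j hij hj) ?_⟩
  have h₁ := hle 0 i (by omega) (by omega)
  have h₂ := hle j _ hj le_rfl
  rw [h0] at h₁
  rw [h1] at h₂
  have h₃ := hX.dist_triangle (u := x) (v := p.getVert i) (w := y)
  have h₄ := hX.dist_triangle (u := p.getVert i) (v := p.getVert j) (w := y)
  omega

theorem between_left {X : SimpleGraph V} (x y : V) : Between X x x y := by simp [Between]

theorem between_right {X : SimpleGraph V} (x y : V) : Between X x y y := by simp [Between]

theorem exists_geodesic {X : SimpleGraph V} (hX : X.Connected) (x y : V) :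
    ∃ c : ℕ → V, c 0 = x ∧ c (X.dist x y) = y ∧
      ∀ i j, i ≤ j → j ≤ X.dist x y → X.dist (c i) (c j) = j - i := by
  obtain ⟨c, h0, -, h1, hc⟩ := (between_left (X := X) x y).exists_geodesic hX
  exact ⟨c, h0, h1, hc⟩

theorem exists_dist_eq {X : SimpleGraph V} (hX : X.Connected) {x y : V} {k : ℕ}
    (hk : k ≤ X.dist x y) : ∃ a, X.dist x a = k ∧ X.dist a y = X.dist x y - k := by
  obtain ⟨c, h0, h1, hc⟩ := exists_geodesic hX x y
  refine ⟨c k, ?_, ?_⟩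
  · have := hc 0 k (by omega) hk
    rwa [h0] at this
  · have := hc k _ hk le_rfl
    rwa [h1] at this

theorem exists_consecutive {P Q : ℕ → Prop} {n : ℕ} (h0 : P 0) (hn : Q n)
    (h : ∀ i ≤ n, P i ∨ Q i) : ∃ i j, i ≤ j ∧ j ≤ i + 1 ∧ j ≤ n ∧ P i ∧ Q j := by
  induction n with
  | zero => exact ⟨0, 0, le_rfl, by omega, le_rfl, h0, hn⟩
  | succ n ih =>
    rcases h n (by omega) with hP | hQ
    · exact ⟨n, n + 1, by omega, le_rfl, le_rfl, hP, hn⟩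
    · obtain ⟨i, j, h₁, h₂, h₃, h₄, h₅⟩ := ih hQ fun i hi => h i (by omega)
      exact ⟨i, j, h₁, h₂, by omega, h₄, h₅⟩

/-- If every vertex of a geodesic satisfies `P` or `Q`, and its endpoints satisfy `P` and `Q`
respectively, then two vertices at distance at most one satisfy `P` and `Q` respectively. -/
theorem exists_dist_le_one_of_between {X : SimpleGraph V} (hX : X.Connected) {x y : V}
    {P Q : V → Prop} (hx : P x) (hy : Q y) (h : ∀ a, Between X x a y → P a ∨ Q a) :
    ∃ a b, Between X x a y ∧ P a ∧ Q b ∧ X.dist a b ≤ 1 := by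
  obtain ⟨c, h0, h1, hc⟩ := exists_geodesic hX x y
  have hbt : ∀ i ≤ X.dist x y, Between X x (c i) y := fun i hi => by
    have h₁ := hc 0 i (by omega) hi
    have h₂ := hc i _ hi le_rfl
    rw [h0] at h₁
    rw [h1] at h₂
    unfold Between
    omega
  obtain ⟨i, j, hij, hji, hj, hP, hQ⟩ := exists_consecutive (P := fun i => P (c i))
    (Q := fun i => Q (c i)) (n := X.dist x y) (by rwa [h0]) (by rwa [h1])
    fun i hi => h _ (hbt i hi)
  refine ⟨c i, c j, hbt i (by omega), hP, hQ, ?_⟩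
  rw [hc i j hij hj]
  omega

/-- Somewhere on `[x, y]` the nearby side switches from `[z, x]` to `[y, z]`, so some `a` is close
to both. Slimness of the triangle `x y w` puts `a` close to `[y, w]` or `[w, x]` as well. Routing
both distances on the left through `a` gives the bound. -/
theorem SlimIntervals.fourPoint {X : SimpleGraph V} (hX : X.Connected) {δ : ℕ}
    (h : SlimIntervals X δ) : FourPoint X (4 * δ + 2) := by
  intro x y z w
  obtain ⟨a, a', ha, ⟨b, hb, hab⟩, ⟨b', hb', hab'⟩, haa'⟩ :=
    exists_dist_le_one_of_between hX (x := x) (y := y)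
      (P := fun a => ∃ b, Between X z b x ∧ X.dist a b ≤ δ)
      (Q := fun a => ∃ b, Between X y b z ∧ X.dist a b ≤ δ)
      ⟨x, between_right z x, by simp⟩ ⟨y, between_left y z, by simp⟩
      (fun a ha => by
        obtain ⟨b, hb | hb, hab⟩ := h x y z a ha
        · exact Or.inr ⟨b, hb, hab⟩
        · exact Or.inl ⟨b, hb, hab⟩)
  obtain ⟨e, he, hae⟩ := h x y w a ha
  unfold Between at *
  have tri := fun u v w => hX.dist_triangle (u := u) (v := v) (w := w)
  have t1 := tri a b z
  have t2 := tri a b x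
  have t3 := tri a a' b'
  have t4 := tri a b' y
  have t5 := tri a b' z
  have t6 := tri a e w
  have t7 := tri a e x
  have t8 := tri a e y
  have t9 := tri z a w
  have s1 := X.dist_comm (u := x) (v := a)
  have s2 := X.dist_comm (u := z) (v := b)
  have s3 := X.dist_comm (u := y) (v := b')
  have s4 := X.dist_comm (u := y) (v := e)
  have s5 := X.dist_comm (u := w) (v := e)
  have s6 := X.dist_comm (u := z) (v := a)
  have s7 := X.dist_comm (u := x) (v := z)
  have s8 := X.dist_comm (u := x) (v := w)
  omega

/-! ### Stability of quasi-geodesics -/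

/-- Bisection of the path: each halving of the index range costs one slim triangle, hence one `δ`,
so the error is logarithmic in the length. -/
theorem SlimIntervals.exists_dist_le_log {X : SimpleGraph V} (hX : X.Connected) {δ : ℕ}
    (h : SlimIntervals X δ) {c : ℕ → V} {K n : ℕ} (hc : ∀ i < n, X.dist (c i) (c (i + 1)) ≤ K)
    (k : ℕ) : ∀ {i j : ℕ}, i ≤ j → j ≤ n → j - i ≤ 2 ^ k → ∀ {a : V}, Between X (c i) a (c j) →
      ∃ l, i ≤ l ∧ l ≤ j ∧ X.dist a (c l) ≤ δ * k + K := by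
  induction k with
  | zero =>
    intro i j hij hj hk a ha
    refine ⟨i, le_rfl, hij, ?_⟩
    have h₁ := dist_le_mul_of_step_le hX hc hij hj
    have h₂ : K * (j - i) ≤ K * 1 := Nat.mul_le_mul_left K (by simpa using hk)
    have h₃ := X.dist_comm (u := a) (v := c i)
    unfold Between at ha
    omega
  | succ k ih =>
    intro i j hij hj hk a ha
    have hk' : j - i ≤ 2 * 2 ^ k := by rwa [pow_succ, mul_comm] at hk
    obtain ⟨m, him, hmj, h₁, h₂⟩ : ∃ m, i ≤ m ∧ m ≤ j ∧ m - i ≤ 2 ^ k ∧ j - m ≤ 2 ^ k :=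
      ⟨i + (j - i) / 2, by omega, by omega, by omega, by omega⟩
    obtain ⟨b, hb, hab⟩ := h _ _ (c m) a ha
    obtain ⟨l, hil, hlj, hl⟩ : ∃ l, i ≤ l ∧ l ≤ j ∧ X.dist b (c l) ≤ δ * k + K := by
      rcases hb with hb | hb
      · obtain ⟨l, h₃, h₄, h₅⟩ := ih hmj hj h₂ hb.symm
        exact ⟨l, by omega, h₄, h₅⟩
      · obtain ⟨l, h₃, h₄, h₅⟩ := ih him (by omega) h₁ hb.symm
        exact ⟨l, h₃, by omega, h₅⟩
    refine ⟨l, hil, hlj, ?_⟩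
    have h₃ := hX.dist_triangle (u := a) (v := b) (w := c l)
    rw [Nat.mul_succ]
    omega

theorem exists_linear_le_two_pow (A B : ℕ) : ∃ k₀, ∀ k ≥ k₀, A * k + B ≤ 2 ^ k := by
  refine ⟨2 * (A + B) + 2, fun k hk => ?_⟩
  obtain ⟨m, hm⟩ : ∃ m, m = k / 2 := ⟨_, rfl⟩
  have h₁ : m + 1 ≤ 2 ^ m := Nat.lt_two_pow_self
  have h₂ : 2 ^ (2 * m) ≤ 2 ^ k := Nat.pow_le_pow_right (by norm_num) (by omega)
  have h₃ : 2 ^ m * 2 ^ m = 2 ^ (2 * m) := by rw [← pow_add]; congr 1; omega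
  have h₄ : k ≤ 2 * m + 1 := by omega
  have h₅ : A + B + 1 ≤ m := by omega
  have h₆ : 2 * m ≤ 2 ^ m := by
    clear h₂ h₃ h₄ h₅ hm
    cases m with
    | zero => simp
    | succ m =>
      have : m + 1 ≤ 2 ^ m := Nat.lt_two_pow_self
      rw [pow_succ]; omega
  -- Splitting `2 ^ (2 * m)` into two factors, each at least linear, gives a quadratic lower bound.
  have h₇ : (2 * m) * (m + 1) ≤ 2 ^ m * 2 ^ m := Nat.mul_le_mul h₆ h₁
  have h₈ : A * k ≤ A * (2 * m + 1) := Nat.mul_le_mul_left A h₄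
  have h₉ : (A + B + 1) * (2 * m + 1) ≤ m * (2 * m + 1) := Nat.mul_le_mul_right _ h₅
  nlinarith

/-- With `k` about `D / (δ + 1)` the second inequality holds, while `2 ^ k` is exponential in `D`
and so beats the linear term. -/
theorem exists_log_bound (δ K : ℕ) : ∃ D₀, ∀ D ≥ D₀, ∃ k, K * (6 * D) + K ≤ 2 ^ k ∧
    2 * δ + δ * k + K < D := by
  obtain ⟨k₀, hk₀⟩ := exists_linear_le_two_pow (6 * K * (δ + 1)) (K * (6 * (4 * δ + K + 3)) + K)
  refine ⟨(δ + 1) * k₀ + 3 * δ + K + 3, fun D hD => ?_⟩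
  obtain ⟨k, hk⟩ : ∃ k, k = (D - (2 * δ + K + 1)) / (δ + 1) := ⟨_, rfl⟩
  have hpos : 0 < δ + 1 := by omega
  have h₁ : (δ + 1) * k ≤ D - (2 * δ + K + 1) := by rw [hk]; exact Nat.mul_div_le _ _
  have h₂ : D - (2 * δ + K + 1) < (δ + 1) * (k + 1) := by
    rw [hk]; exact Nat.lt_mul_div_succ _ hpos
  have h₃ : k₀ ≤ k := by
    rw [hk, Nat.le_div_iff_mul_le hpos, mul_comm]
    omega
  refine ⟨k, le_trans ?_ (hk₀ k h₃), ?_⟩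
  · have h₄ : D ≤ (δ + 1) * k + (4 * δ + K + 3) := by
      rw [Nat.mul_succ] at h₂
      omega
    have h₅ := Nat.mul_le_mul_left (6 * K) h₄
    nlinarith
  · rw [Nat.succ_mul] at h₁
    omega

theorem SlimIntervals.quadrilateral {X : SimpleGraph V} (hX : X.Connected) {δ : ℕ}
    (h : SlimIntervals X δ) {x y z w a : V} (ha : Between X x a w) :
    ∃ b, (Between X x b y ∨ Between X y b z ∨ Between X z b w) ∧ X.dist a b ≤ 2 * δ := by
  obtain ⟨b, hb, hab⟩ := h x w z a ha
  rcases hb with hb | hb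
  · exact ⟨b, Or.inr (Or.inr hb.symm), by omega⟩
  · obtain ⟨e, he, hbe⟩ := h x z y b hb.symm
    have h₃ := hX.dist_triangle (u := a) (v := b) (w := e)
    refine ⟨e, ?_, by omega⟩
    rcases he with he | he
    · exact Or.inr (Or.inl he.symm)
    · exact Or.inl he.symm

/-- Geodesics stay close to quasi-geodesics with the same endpoints. -/
theorem SlimIntervals.exists_geodesic_near {X : SimpleGraph V} (hX : X.Connected) {δ : ℕ}
    (h : SlimIntervals X δ) (K : ℕ) : ∃ D₀ : ℕ, ∀ (n : ℕ) (c : ℕ → V),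
      (∀ i < n, X.dist (c i) (c (i + 1)) ≤ K) →
      (∀ i j, i ≤ j → j ≤ n → j - i ≤ K * X.dist (c i) (c j) + K) →
      ∀ a, Between X (c 0) a (c n) → ∃ i ≤ n, X.dist a (c i) ≤ D₀ := by
  classical
  obtain ⟨D₀, hD₀⟩ := exists_log_bound δ K
  refine ⟨D₀, fun n c hc hq => ?_⟩
  by_contra! hcon
  obtain ⟨a₀, ha₀, hfar₀⟩ := hcon
  -- `D` is the largest distance from a point of the interval to the quasi-geodesic
  let S : ℕ → Prop := fun D => ∃ a, Between X (c 0) a (c n) ∧ ∀ i ≤ n, D ≤ X.dist a (c i)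
  have hS₀ : S D₀ := ⟨a₀, ha₀, fun i hi => (hfar₀ i hi).le⟩
  have hbdd : ∀ D, S D → D ≤ X.dist (c 0) (c n) := by
    rintro D ⟨a, ha, hfar⟩
    have h₁ := hfar 0 (by omega)
    have h₂ := X.dist_comm (u := c 0) (v := a)
    unfold Between at ha
    omega
  obtain ⟨D, hDge, ⟨a, ha, hfar⟩, hmax⟩ : ∃ D, D₀ ≤ D ∧ S D ∧ ∀ D', S D' → D' ≤ D := by
    refine ⟨Nat.findGreatest S (X.dist (c 0) (c n)), Nat.le_findGreatest (hbdd _ hS₀) hS₀,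
      Nat.findGreatest_spec (hbdd _ hS₀) hS₀, fun D' h' => Nat.le_findGreatest (hbdd _ h') h'⟩
  have hnear : ∀ b, Between X (c 0) b (c n) → ∃ i ≤ n, X.dist b (c i) ≤ D := by
    intro b hb
    by_contra! hcon
    have := hmax (D + 1) ⟨b, hb, hcon⟩
    omega
  have tri := fun u v w => hX.dist_triangle (u := u) (v := v) (w := w)
  -- points of a geodesic at distance `2 D` from `a`, or endpoints
  have side : ∀ e : ℕ, e ≤ n → (∀ b, Between X a b (c e) → Between X (c 0) b (c n)) →
      ∃ y i, i ≤ n ∧ Between X a y (c e) ∧ X.dist a y ≤ 2 * D ∧ X.dist y (c i) ≤ D ∧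
        ∀ b, Between X y b (c i) → D ≤ X.dist a b := by
    intro e he hsub
    by_cases hlt : X.dist a (c e) ≤ 2 * D
    · refine ⟨c e, e, he, between_right _ _, hlt, by simp, fun b hb => ?_⟩
      have h₁ := hfar e he
      have h₂ : X.dist (c e) b = 0 := by
        unfold Between at hb
        simp only [SimpleGraph.dist_self] at hb
        omega
      have h₃ := tri a b (c e)
      have h₄ := X.dist_comm (u := c e) (v := b)
      omega
    · obtain ⟨y, hy₁, hy₂⟩ := exists_dist_eq hX (x := a) (y := c e) (k := 2 * D) (by omega)
      have hy : Between X a y (c e) := by unfold Between; omega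
      obtain ⟨i, hi, hyi⟩ := hnear y (hsub y hy)
      refine ⟨y, i, hi, hy, hy₁.le, hyi, fun b hb => ?_⟩
      have h₁ := tri a b y
      have h₂ := X.dist_comm (u := y) (v := b)
      unfold Between at hb
      omega
  obtain ⟨y, i, hi, hy, hyD, hyi, hyfar⟩ := side 0 (by omega) fun b hb => by
    have h₁ := tri (c 0) b (c n)
    have h₂ := tri b a (c n)
    have h₃ := X.dist_comm (u := a) (v := b)
    have h₄ := X.dist_comm (u := c 0) (v := b)
    have h₅ := X.dist_comm (u := c 0) (v := a)
    unfold Between at *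
    omega
  obtain ⟨z, j, hj, hz, hzD, hzj, hzfar⟩ := side n le_rfl fun b hb => by
    have h₁ := tri (c 0) b (c n)
    have h₂ := tri (c 0) a b
    unfold Between at *
    omega
  have hayz : Between X y a z := by
    have h₁ := tri (c 0) y (c n)
    have h₂ := tri y z (c n)
    have h₃ := tri y a z
    have h₄ := X.dist_comm (u := c 0) (v := y)
    have h₅ := X.dist_comm (u := c 0) (v := a)
    have h₆ := X.dist_comm (u := a) (v := y)
    unfold Between at *
    omega
  have hij : X.dist (c i) (c j) ≤ 6 * D := by
    have h₁ := tri (c i) y (c j)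
    have h₂ := tri y z (c j)
    have h₃ := tri y a z
    have h₄ := X.dist_comm (u := c i) (v := y)
    have h₅ := X.dist_comm (u := a) (v := y)
    omega
  obtain ⟨k, hk₁, hk₂⟩ := hD₀ D hDge
  -- The sides at `y` and `z` stay at distance `D > 2 * δ` from `a`, so `b` lies between `c i` and
  -- `c j`. Their index gap is at most `2 ^ k`, and the logarithmic bound puts `a` closer than `D`
  -- to the path.
  obtain ⟨b, hb, hab⟩ := h.quadrilateral hX (x := y) (y := c i) (z := c j) (w := z) hayz
  rcases hb with hb | hb | hb
  · have := hyfar b hb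
    have : 0 ≤ δ * k := Nat.zero_le _
    omega
  · have key : ∀ {i j : ℕ}, i ≤ j → j ≤ n → X.dist (c i) (c j) ≤ 6 * D →
        Between X (c i) b (c j) → False := by
      intro i j hij' hj hd hb
      have h₁ := hq i j hij' hj
      have h₂ : K * X.dist (c i) (c j) ≤ K * (6 * D) := Nat.mul_le_mul_left K hd
      obtain ⟨l, hil, hlj, hl⟩ := h.exists_dist_le_log hX hc k hij' hj (by omega) hb
      have h₃ := hfar l (by omega)
      have h₄ := tri a b (c l)
      omega
    rcases le_total i j with hle | hle
    · exact key hle hj hij hb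
    · exact key hle hi (by rwa [SimpleGraph.dist_comm]) hb.symm
  · have := hzfar b hb.symm
    have : 0 ≤ δ * k := Nat.zero_le _
    omega

/-- Quasi-geodesics stay close to geodesics with the same endpoints. -/
theorem SlimIntervals.exists_quasiGeodesic_near {X : SimpleGraph V} (hX : X.Connected) {δ : ℕ}
    (h : SlimIntervals X δ) (K : ℕ) : ∃ D₁ : ℕ, ∀ (n : ℕ) (c : ℕ → V),
      (∀ i < n, X.dist (c i) (c (i + 1)) ≤ K) →
      (∀ i j, i ≤ j → j ≤ n → j - i ≤ K * X.dist (c i) (c j) + K) →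
      ∀ m ≤ n, ∃ a, Between X (c 0) a (c n) ∧ X.dist (c m) a ≤ D₁ := by
  obtain ⟨D₀, hD₀⟩ := h.exists_geodesic_near hX K
  refine ⟨K * (K * (2 * D₀ + 1) + K) + D₀, fun n c hc hq m hm => ?_⟩
  have hnear := hD₀ n c hc hq
  -- The geodesic passes from being near the path before time `m` to being near it after `m`. At the
  -- switch `c i` and `c j` are close with `i ≤ m ≤ j`; the quasi-geodesic inequality bounds `j -
  -- i`, so `c m` is near `c i`.
  obtain ⟨a, a', ha, ⟨i, him, hi⟩, ⟨j, hmj, hjn, hj⟩, haa'⟩ :=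
    exists_dist_le_one_of_between hX (x := c 0) (y := c n)
      (P := fun a => ∃ i ≤ m, X.dist a (c i) ≤ D₀)
      (Q := fun a => ∃ i, m ≤ i ∧ i ≤ n ∧ X.dist a (c i) ≤ D₀)
      ⟨0, by omega, by simp⟩ ⟨n, hm, le_rfl, by simp⟩
      (fun a ha => by
        obtain ⟨i, hi, hai⟩ := hnear a ha
        rcases le_total i m with him | him
        · exact Or.inl ⟨i, him, hai⟩
        · exact Or.inr ⟨i, him, hi, hai⟩)
  refine ⟨a, ha, ?_⟩
  have tri := fun u v w => hX.dist_triangle (u := u) (v := v) (w := w)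
  have h₁ := tri (c i) a (c j)
  have h₂ := tri a a' (c j)
  have h₃ := X.dist_comm (u := a) (v := c i)
  have h₄ : X.dist (c i) (c j) ≤ 2 * D₀ + 1 := by omega
  have h₅ := hq i j (by omega) hjn
  have h₆ : K * X.dist (c i) (c j) ≤ K * (2 * D₀ + 1) := Nat.mul_le_mul_left K h₄
  have h₇ := dist_le_mul_of_step_le hX hc him hm
  have h₈ : K * (m - i) ≤ K * (K * (2 * D₀ + 1) + K) := Nat.mul_le_mul_left K (by omega)
  have h₉ := tri (c m) (c i) a
  have h₁₀ := X.dist_comm (u := c m) (v := c i)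
  omega

end HyperbolicGraphs

/-! ### Cayley–Abels graphs and invariance of hyperbolicity -/

section CayleyAbels

theorem dist_smul {G : Type u} [Group G] {V : Type v} [MulAction G V] (X : SimpleGraph V)
    [IsGraphAction G X] (g : G) (a b : V) : X.dist (g • a) (g • b) = X.dist a b :=
  congrArg ENat.toNat (edist_smul X g a b)

theorem dist_smul_smul {G : Type u} [Group G] {V : Type v} [MulAction G V] (X : SimpleGraph V)
    [IsGraphAction G X] (g h : G) (a b : V) :
    X.dist (g • a) (h • b) = X.dist a ((g⁻¹ * h) • b) := by
  rw [← dist_smul X g⁻¹, inv_smul_smul, mul_smul]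

theorem finite_ball {V : Type v} {X : SimpleGraph V} (hX : X.Connected)
    (hfin : ∀ a, (X.neighborSet a).Finite) (x : V) (n : ℕ) : {y | X.dist x y ≤ n}.Finite := by
  induction n with
  | zero =>
    refine (Set.finite_singleton x).subset fun y hy => ?_
    have : X.dist x y = 0 := by simpa using hy
    exact (hX.dist_eq_zero_iff.1 this).symm
  | succ n ih =>
    refine (ih.union (ih.biUnion fun a _ => hfin a)).subset fun y hy => ?_
    by_cases h : X.dist x y ≤ n
    · exact Or.inl h
    · have hy' : X.dist x y = n + 1 := by
        simp only [mem_ofPred_eq] at hy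
        omega
      obtain ⟨a, ha, hay⟩ := exists_dist_eq hX (x := x) (y := y) (k := n) (by omega)
      refine Or.inr (mem_biUnion (x := a) ha.le ?_)
      exact SimpleGraph.dist_eq_one_iff_adj.1 (by omega)

variable {G : Type u} [Group G] [TopologicalSpace G] [IsTopologicalGroup G]
  {V : Type v} [MulAction G V]

theorem isCompact_setOf_smul_eq (X : SimpleGraph V) [hX : IsCayleyAbelsGraph G X] (x y : V) :
    IsCompact {g : G | g • x = y} := by
  obtain ⟨h, rfl⟩ := hX.isPretransitive.exists_smul_eq x y
  have := (hX.isCompact_stabilizer x).image (continuous_const_mul h)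
  refine (congrArg IsCompact (Set.ext fun g => ?_)).mp this
  simp only [mem_image, SetLike.mem_coe, MulAction.mem_stabilizer_iff, mem_ofPred_eq]
  constructor
  · rintro ⟨k, hk, rfl⟩
    rw [mul_smul, hk]
  · intro hg
    exact ⟨h⁻¹ * g, by rw [mul_smul, hg, inv_smul_smul], by simp⟩

theorem isCompact_setOf_dist_smul_le (X : SimpleGraph V) [hX : IsCayleyAbelsGraph G X] (x : V)
    (n : ℕ) : IsCompact {g : G | X.dist x (g • x) ≤ n} := by
  have := (finite_ball hX.connected hX.finite_neighborSet x n).isCompact_biUnion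
    fun y _ => isCompact_setOf_smul_eq (G := G) X x y
  refine (congrArg IsCompact (Set.ext fun g => ?_)).mp this
  simp

theorem continuous_smul_vertex (X : SimpleGraph V) [hX : IsCayleyAbelsGraph G X]
    [TopologicalSpace V] [DiscreteTopology V] (x : V) : Continuous fun g : G => g • x := by
  rw [continuous_discrete_rng]
  intro y
  rw [isOpen_iff_mem_nhds]
  rintro h rfl
  have h₁ : (fun g : G => h⁻¹ * g) ⁻¹' (MulAction.stabilizer G x) ∈ nhds h :=
    (continuous_const_mul h⁻¹).continuousAt.preimage_mem_nhds
      (by simpa using (hX.isOpen_stabilizer x).mem_nhds (one_mem _))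
  refine Filter.mem_of_superset h₁ fun g hg => ?_
  have : h⁻¹ • g • x = x := by rw [← mul_smul]; exact hg
  rw [inv_smul_eq_iff] at this
  exact this

theorem continuousSMul_vertex (X : SimpleGraph V) [IsCayleyAbelsGraph G X]
    [TopologicalSpace V] [DiscreteTopology V] : ContinuousSMul G V :=
  ⟨continuous_prod_of_discrete_right.2 fun x => continuous_smul_vertex X x⟩

/-- Any two Cayley–Abels graphs of a group are quasi-isometric. -/
theorem exists_dist_smul_le {W : Type*} [MulAction G W] (X : SimpleGraph V)
    [IsCayleyAbelsGraph G X] (Y : SimpleGraph W) [hY : IsCayleyAbelsGraph G Y] (x : V) (y : W) :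
    ∃ K : ℕ, ∀ g : G, X.dist x (g • x) ≤ K * Y.dist y (g • y) + K := by
  let _ : TopologicalSpace V := ⊥
  have _ : DiscreteTopology V := ⟨rfl⟩
  have hX : X.Connected := IsCayleyAbelsGraph.connected G
  obtain ⟨K, hK⟩ := (isCompact_setOf_dist_smul_le (G := G) Y y 1).bddAbove_image
    (f := fun g : G => X.dist x (g • x))
    ((continuous_of_discreteTopology (f := fun z => X.dist x z)).comp
      (continuous_smul_vertex X x)).continuousOn
  have hK' : ∀ g : G, Y.dist y (g • y) ≤ 1 → X.dist x (g • x) ≤ K :=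
    fun g hg => hK (mem_image_of_mem _ hg)
  refine ⟨K, fun g => ?_⟩
  obtain ⟨n, hn⟩ : ∃ n, Y.dist y (g • y) = n := ⟨_, rfl⟩
  rw [hn]
  induction n generalizing g with
  | zero => simpa using hK' g (by omega)
  | succ n ih =>
    obtain ⟨z, hz₁, hz₂⟩ := exists_dist_eq hY.connected (x := y) (y := g • y) (k := n) (by omega)
    obtain ⟨h, rfl⟩ := hY.isPretransitive.exists_smul_eq y z
    have h₁ := ih h hz₁
    -- `g = h * (h⁻¹ * g)`, where the second factor displaces `y` by one and hence `x` by at most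
    -- `K`.
    have h₂ := hK' (h⁻¹ * g) (by rw [← dist_smul_smul]; omega)
    rw [← dist_smul_smul] at h₂
    have h₃ := hX.dist_triangle (u := x) (v := h • x) (w := g • x)
    rw [Nat.mul_succ]
    omega

/-- Hyperbolicity does not depend on the Cayley–Abels graph. -/
theorem SlimIntervals.exists_slimIntervals {W : Type*} [MulAction G W] (X : SimpleGraph V)
    [hX : IsCayleyAbelsGraph G X] (Y : SimpleGraph W) [hY : IsCayleyAbelsGraph G Y] {δ : ℕ}
    (h : SlimIntervals Y δ) : ∃ δ', SlimIntervals X δ' := by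
  have hXc := hX.connected
  have hYc := hY.connected
  obtain ⟨x₀⟩ := hXc.nonempty
  obtain ⟨y₀⟩ := hYc.nonempty
  obtain ⟨K₁, hK₁⟩ := exists_dist_smul_le (G := G) X Y x₀ y₀
  obtain ⟨K₂, hK₂⟩ := exists_dist_smul_le (G := G) Y X y₀ x₀
  -- The map `a ↦ σ a • y₀` is a quasi-isometry from `X` to `Y`, whatever choices `σ` makes.
  choose σ hσ using hX.isPretransitive.exists_smul_eq x₀
  have hf₁ : ∀ a b, X.dist a b ≤ K₁ * Y.dist (σ a • y₀) (σ b • y₀) + K₁ := fun a b => by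
    have := hK₁ ((σ a)⁻¹ * σ b)
    rwa [← dist_smul_smul, ← dist_smul_smul, hσ, hσ] at this
  have hf₂ : ∀ a b, Y.dist (σ a • y₀) (σ b • y₀) ≤ K₂ * X.dist a b + K₂ := fun a b => by
    have := hK₂ ((σ a)⁻¹ * σ b)
    rwa [← dist_smul_smul, ← dist_smul_smul, hσ, hσ] at this
  obtain ⟨K, hKK₁, hKK₂⟩ : ∃ K, K₁ ≤ K ∧ 2 * K₂ ≤ K := ⟨K₁ + 2 * K₂, by omega, by omega⟩
  have hqg : ∀ {x y : V} {c : ℕ → V},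
      (∀ i j, i ≤ j → j ≤ X.dist x y → X.dist (c i) (c j) = j - i) →
      (∀ i < X.dist x y, Y.dist (σ (c i) • y₀) (σ (c (i + 1)) • y₀) ≤ K) ∧
      ∀ i j, i ≤ j → j ≤ X.dist x y →
        j - i ≤ K * Y.dist (σ (c i) • y₀) (σ (c j) • y₀) + K := by
    intro x y c hc
    refine ⟨fun i hi => ?_, fun i j hij hj => ?_⟩
    · have h₁ := hf₂ (c i) (c (i + 1))
      rw [hc i (i + 1) (by omega) (by omega)] at h₁
      simp only [Nat.add_sub_cancel_left, mul_one] at h₁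
      omega
    · have h₁ := hf₁ (c i) (c j)
      rw [hc i j hij hj] at h₁
      have h₂ := Nat.mul_le_mul_right (Y.dist (σ (c i) • y₀) (σ (c j) • y₀)) hKK₁
      omega
  obtain ⟨D₀, hD₀⟩ := h.exists_geodesic_near hYc K
  obtain ⟨D₁, hD₁⟩ := h.exists_quasiGeodesic_near hYc K
  have fwd : ∀ x a y, Between X x a y →
      ∃ a', Between Y (σ x • y₀) a' (σ y • y₀) ∧ Y.dist (σ a • y₀) a' ≤ D₁ := by
    intro x a y ha
    obtain ⟨c, h0, hca, h1, hc⟩ := ha.exists_geodesic hXc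
    obtain ⟨a', ha', hd⟩ := hD₁ (X.dist x y) (fun i => σ (c i) • y₀) (hqg hc).1 (hqg hc).2
      (X.dist x a) (by unfold Between at ha; omega)
    simp only [h0, h1, hca] at ha' hd
    exact ⟨a', ha', hd⟩
  have bwd : ∀ x y b', Between Y (σ x • y₀) b' (σ y • y₀) →
      ∃ b, Between X x b y ∧ Y.dist b' (σ b • y₀) ≤ D₀ := by
    intro x y b' hb'
    obtain ⟨c, h0, h1, hc⟩ := exists_geodesic hXc x y
    obtain ⟨i, hi, hd⟩ := hD₀ (X.dist x y) (fun i => σ (c i) • y₀) (hqg hc).1 (hqg hc).2 b'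
      (by simpa only [h0, h1] using hb')
    refine ⟨c i, ?_, hd⟩
    have h₁ := hc 0 i (by omega) hi
    have h₂ := hc i _ hi le_rfl
    rw [h0] at h₁
    rw [h1] at h₂
    unfold Between
    omega
  -- In `Y`: from the image of `a` to a geodesic (`D₁`), to another side (`δ`), to the image of a
  -- geodesic of `X` (`D₀`).
  refine ⟨K₁ * (D₁ + δ + D₀) + K₁, fun x y z a ha => ?_⟩
  obtain ⟨a', ha', haa'⟩ := fwd x a y ha
  obtain ⟨b', hb', hab'⟩ := h _ _ (σ z • y₀) a' ha'
  have key : ∀ b, Y.dist b' (σ b • y₀) ≤ D₀ → X.dist a b ≤ K₁ * (D₁ + δ + D₀) + K₁ := by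
    intro b hb
    have h₁ := hYc.dist_triangle (u := σ a • y₀) (v := a') (w := σ b • y₀)
    have h₂ := hYc.dist_triangle (u := a') (v := b') (w := σ b • y₀)
    exact (hf₁ a b).trans (Nat.add_le_add_right (Nat.mul_le_mul_left _ (by omega)) _)
  rcases hb' with hb' | hb'
  · obtain ⟨b, hb, hbb'⟩ := bwd y z b' hb'
    exact ⟨b, Or.inl hb, key b hbb'⟩
  · obtain ⟨b, hb, hbb'⟩ := bwd z x b' hb'
    exact ⟨b, Or.inr hb, key b hbb'⟩

theorem IsHyperbolicGroup.exists_fourPoint (hG : IsHyperbolicGroup G) (X : SimpleGraph V)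
    [IsCayleyAbelsGraph G X] : ∃ δ, FourPoint X δ := by
  obtain ⟨-, W, _, Y, hY, hhyp⟩ := hG
  obtain ⟨δ, hδ⟩ := hhyp.exists_slimIntervals hY.connected
  obtain ⟨δ', hδ'⟩ := hδ.exists_slimIntervals (G := G) X
  exact ⟨_, hδ'.fourPoint (IsCayleyAbelsGraph.connected G)⟩

end CayleyAbels

/-! ### Geodesic rays, their divergence, and centres of triples -/

section Rays

variable {V : Type v} {X : SimpleGraph V}

namespace GeodesicRay

theorem dist_eq (α : GeodesicRay X) {m n : ℕ} (h : m ≤ n) :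
    X.dist (α.toFun m) (α.toFun n) = n - m := by
  obtain ⟨k, rfl⟩ := Nat.exists_eq_add_of_le h
  have := congrArg ENat.toNat (α.edist_eq m k)
  rw [ENat.toNat_natCast] at this
  rw [Nat.add_sub_cancel_left]
  exact this

theorem dist_eq' (α : GeodesicRay X) {m n : ℕ} (h : m ≤ n) :
    X.dist (α.toFun n) (α.toFun m) = n - m := by
  rw [SimpleGraph.dist_comm, α.dist_eq h]

theorem edist_le_coe (hX : X.Connected) {a b : V} {n : ℕ} :
    X.edist a b ≤ n ↔ X.dist a b ≤ n := by
  rw [← (hX.preconnected a b).coe_dist_eq_edist, Nat.cast_le]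

theorem asymptotic_of_dist_le (hX : X.Connected) {α β : GeodesicRay X} {C : ℕ}
    (h : ∀ n, X.dist (α.toFun n) (β.toFun n) ≤ C) : Asymptotic α β :=
  ⟨C, fun n => ⟨n, (edist_le_coe hX).2 (h n)⟩,
    fun n => ⟨n, (edist_le_coe hX).2 (by rw [SimpleGraph.dist_comm]; exact h n)⟩⟩

/-- A distant `β k` near `α` serves as a common target: the four point condition puts `α n` within
error `δ` of lying on a geodesic from `α 0` to `β k`. A second application compares it with `β n`.
The bound no longer involves the Hausdorff constant. -/
theorem Asymptotic.dist_le (hX : X.Connected) {δ : ℕ} (hδ : FourPoint X δ)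
    {α β : GeodesicRay X} (h : Asymptotic α β) (n : ℕ) :
    X.dist (α.toFun n) (β.toFun n) ≤ 2 * δ + X.dist (α.toFun 0) (β.toFun 0) := by
  obtain ⟨C, h, -⟩ := h
  obtain ⟨m, hm⟩ : ∃ m, m = n + 2 * C + δ + X.dist (α.toFun 0) (β.toFun 0) + 1 := ⟨_, rfl⟩
  obtain ⟨k, hk⟩ := h m
  rw [edist_le_coe hX] at hk
  have tri := fun u v w => hX.dist_triangle (u := u) (v := v) (w := w)
  have e₁ := α.dist_eq (m := 0) (n := n) (by omega)
  have e₂ := α.dist_eq (m := 0) (n := m) (by omega)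
  have e₃ := α.dist_eq (m := n) (n := m) (by omega)
  have e₄ := β.dist_eq (m := 0) (n := k) (by omega)
  have e₅ := β.dist_eq (m := 0) (n := n) (by omega)
  have e₆ := X.dist_comm (u := β.toFun k) (v := α.toFun m)
  have e₇ := X.dist_comm (u := β.toFun k) (v := α.toFun 0)
  have e₈ := X.dist_comm (u := β.toFun 0) (v := α.toFun 0)
  have e₉ := X.dist_comm (u := α.toFun n) (v := α.toFun 0)
  have e₁₀ := X.dist_comm (u := β.toFun n) (v := α.toFun 0)
  have t₁ := tri (α.toFun 0) (β.toFun 0) (β.toFun k)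
  have t₂ := tri (β.toFun 0) (α.toFun 0) (β.toFun k)
  have t₃ := tri (α.toFun 0) (β.toFun k) (α.toFun m)
  have t₄ := tri (α.toFun 0) (β.toFun 0) (β.toFun n)
  have t₅ := tri (α.toFun n) (β.toFun k) (α.toFun m)
  have f₁ := hδ (α.toFun n) (β.toFun k) (α.toFun 0) (α.toFun m)
  have hnk : n ≤ k := by omega
  have e₁₁ := β.dist_eq hnk
  have f₂ := hδ (α.toFun n) (β.toFun n) (α.toFun 0) (β.toFun k)
  omega

/-- Limit of geodesics from `x` to `p m` along a nonprincipal ultrafilter: balls are finite, so each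
vertex of the limit is attained for ultrafilter-many `m`. -/
theorem exists_of_tendsto (hX : X.Connected) (hfin : ∀ a, (X.neighborSet a).Finite) (x : V)
    {p : ℕ → V} (hp : ∀ m, m ≤ X.dist x (p m)) :
    ∃ β : GeodesicRay X, β.toFun 0 = x ∧
      ∀ n, ∃ m, n ≤ m ∧ Between X x (β.toFun n) (p m) := by
  choose c h0 h1 hc using fun m => exists_geodesic hX x (p m)
  have hlarge : ∀ n, ∀ᶠ m in (Filter.hyperfilter ℕ : Filter ℕ), n ≤ m := fun n =>
    (Nat.cofinite_eq_atTop ▸ Filter.hyperfilter_le_cofinite (α := ℕ)) (Filter.eventually_ge_atTop n)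
  have hlim : ∀ n, ∃ y, ∀ᶠ m in (Filter.hyperfilter ℕ : Filter ℕ), c m n = y := by
    intro n
    have hball : (⋃ y ∈ {y | X.dist x y ≤ n}, {m | c m n = y}) ∈ Filter.hyperfilter ℕ := by
      refine Filter.mem_of_superset (hlarge n) fun m (hm : n ≤ m) => ?_
      have := hc m 0 n (by omega) (hm.trans (hp m))
      rw [h0] at this
      exact mem_biUnion (x := c m n) (show X.dist x (c m n) ≤ n by omega) rfl
    obtain ⟨y, -, hy⟩ := (Ultrafilter.finite_biUnion_mem_iff (finite_ball hX hfin x n)).1 hball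
    exact ⟨y, hy⟩
  choose b hb using hlim
  refine ⟨⟨b, fun i n => ?_⟩, ?_, fun n => ?_⟩
  · obtain ⟨m, hm, h₁, h₂⟩ := ((hlarge (i + n)).and ((hb i).and (hb (i + n)))).exists
    rw [← (hX.preconnected _ _).coe_dist_eq_edist, ← h₁, ← h₂,
      hc m i (i + n) (by omega) (hm.trans (hp m)), Nat.add_sub_cancel_left]
  · obtain ⟨m, hm⟩ := (hb 0).exists
    exact hm.symm.trans (h0 m)
  · obtain ⟨m, hm, h₁⟩ := ((hlarge n).and (hb n)).exists
    refine ⟨m, hm, ?_⟩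
    have h₂ := hc m 0 n (by omega) (hm.trans (hp m))
    have h₃ := hc m n _ (hm.trans (hp m)) le_rfl
    have h₄ := hp m
    rw [h0] at h₂
    rw [h1] at h₃
    change Between X x (b n) (p m)
    unfold Between
    rw [← h₁]
    omega

/-- Every boundary point is represented by a ray that starts at a given vertex. -/
theorem exists_asymptotic (hX : X.Connected) (hfin : ∀ a, (X.neighborSet a).Finite) {δ : ℕ}
    (hδ : FourPoint X δ) (α : GeodesicRay X) (x : V) :
    ∃ β : GeodesicRay X, β.toFun 0 = x ∧ Asymptotic β α := by
  obtain ⟨L, hL⟩ : ∃ L, L = X.dist x (α.toFun 0) := ⟨_, rfl⟩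
  have tri := fun u v w => hX.dist_triangle (u := u) (v := v) (w := w)
  obtain ⟨β, hβ, h⟩ := exists_of_tendsto hX hfin x (p := fun m => α.toFun (m + L)) fun m => by
    have h₁ := tri (α.toFun 0) x (α.toFun (m + L))
    have h₂ := α.dist_eq (m := 0) (n := m + L) (by omega)
    have h₃ := X.dist_comm (u := x) (v := α.toFun 0)
    omega
  refine ⟨β, hβ, asymptotic_of_dist_le hX (C := L + δ) fun n => ?_⟩
  obtain ⟨m, hnm, hm⟩ := h n
  have e₁ := α.dist_eq (m := 0) (n := n) (by omega)
  have e₂ := α.dist_eq (m := n) (n := m + L) (by omega)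
  have e₃ := α.dist_eq (m := 0) (n := m + L) (by omega)
  have e₄ := β.dist_eq (m := 0) (n := n) (by omega)
  rw [hβ] at e₄
  have e₅ := X.dist_comm (u := β.toFun n) (v := x)
  have e₆ := X.dist_comm (u := α.toFun n) (v := x)
  have t₁ := tri x (α.toFun 0) (α.toFun n)
  have t₂ := tri (α.toFun 0) x (α.toFun (m + L))
  have e₇ := X.dist_comm (u := x) (v := α.toFun 0)
  have f := hδ (β.toFun n) (α.toFun n) x (α.toFun (m + L))
  unfold Between at hm
  omega

/-- Rays with a common origin which are far apart at some time diverge linearly from then on. -/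
theorem two_mul_le_dist_add (hX : X.Connected) {δ : ℕ} (hδ : FourPoint X δ)
    {α β : GeodesicRay X} (h0 : α.toFun 0 = β.toFun 0) {n D : ℕ} (hn : n ≤ D)
    (h : 2 * δ < X.dist (α.toFun n) (β.toFun n)) (m : ℕ) :
    2 * m ≤ X.dist (α.toFun m) (β.toFun m) + 2 * D + δ := by
  -- The negation says that the Gromov product of `α m` and `β m` at the origin exceeds `D + δ / 2`;
  -- two four point inequalities then force the rays to be `2 * δ`-close at time `n`.
  by_contra! hcon
  have hnm : n ≤ m := by omega
  have tri := fun u v w => hX.dist_triangle (u := u) (v := v) (w := w)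
  have e₁ := α.dist_eq (m := 0) (n := n) (by omega)
  have e₂ := α.dist_eq (m := 0) (n := m) (by omega)
  have e₃ := α.dist_eq hnm
  have e₄ := β.dist_eq (m := 0) (n := m) (by omega)
  have e₅ := β.dist_eq (m := 0) (n := n) (by omega)
  have e₆ := β.dist_eq hnm
  rw [← h0] at e₄ e₅
  have c₁ := X.dist_comm (u := α.toFun n) (v := α.toFun 0)
  have c₂ := X.dist_comm (u := β.toFun n) (v := α.toFun 0)
  have c₃ := X.dist_comm (u := β.toFun m) (v := α.toFun 0)
  have c₄ := X.dist_comm (u := β.toFun m) (v := α.toFun m)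
  have t₅ := tri (α.toFun n) (β.toFun m) (α.toFun m)
  have f₁ := hδ (α.toFun n) (β.toFun m) (α.toFun 0) (α.toFun m)
  have f₂ := hδ (α.toFun n) (β.toFun n) (α.toFun 0) (β.toFun m)
  omega

theorem exists_lt_dist_of_not_asymptotic (hX : X.Connected) {α β : GeodesicRay X}
    (h : ¬ Asymptotic α β) (C : ℕ) : ∃ n, C < X.dist (α.toFun n) (β.toFun n) := by
  by_contra! hcon
  exact h (asymptotic_of_dist_le hX hcon)

/-- Twice the Gromov product, `2 * m - dist (α m) (β m)`, is a monotone bounded sequence of natural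
numbers, hence eventually constant. -/
theorem eventually_dist_eq_add (hX : X.Connected) {δ : ℕ} (hδ : FourPoint X δ)
    {α β : GeodesicRay X} (h0 : α.toFun 0 = β.toFun 0) (h : ¬ Asymptotic α β) :
    ∀ᶠ N in Filter.atTop, ∀ M ≥ N, X.dist (α.toFun M) (β.toFun M) =
      X.dist (α.toFun N) (β.toFun N) + 2 * (M - N) := by
  obtain ⟨n, hn⟩ := exists_lt_dist_of_not_asymptotic hX h (2 * δ)
  have hbd := two_mul_le_dist_add hX hδ h0 le_rfl hn
  have tri := fun u v w => hX.dist_triangle (u := u) (v := v) (w := w)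
  obtain ⟨f, hf⟩ : ∃ f : ℕ → ℕ, ∀ m, f m = 2 * m - X.dist (α.toFun m) (β.toFun m) :=
    ⟨_, fun _ => rfl⟩
  have hle : ∀ m, X.dist (α.toFun m) (β.toFun m) ≤ 2 * m := fun m => by
    have e₁ := α.dist_eq' (m := 0) (n := m) (by omega)
    have e₂ := β.dist_eq (m := 0) (n := m) (by omega)
    rw [← h0] at e₂
    have := tri (α.toFun m) (α.toFun 0) (β.toFun m)
    omega
  have hmono : Monotone f := fun m k hmk => by
    have e₁ := α.dist_eq hmk
    have e₂ := β.dist_eq' hmk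
    have e₃ := α.dist_eq' hmk
    have e₄ := β.dist_eq hmk
    have t₁ := tri (α.toFun k) (α.toFun m) (β.toFun k)
    have t₂ := tri (α.toFun m) (β.toFun m) (β.toFun k)
    have h₁ := hle m
    have h₂ := hle k
    rw [hf, hf]
    omega
  have hbdd : BddAbove (range f) := ⟨2 * n + δ, by
    rintro _ ⟨m, rfl⟩
    have := hbd m
    rw [hf]
    omega⟩
  obtain ⟨N₀, hN₀⟩ := Nat.sSup_mem (range_nonempty f) hbdd
  filter_upwards [Filter.eventually_ge_atTop N₀] with N hN M hM
  have h₁ := hmono hN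
  have h₂ := hmono hM
  have h₃ : f M ≤ f N₀ := by
    rw [hN₀]
    exact le_csSup hbdd ⟨M, rfl⟩
  have h₄ := hle M
  have h₅ := hle N
  rw [hf] at h₁
  rw [hf, hf] at h₂
  rw [hf, hf] at h₃
  rw [hf] at h₁
  omega

theorem Asymptotic.eventually_dist_add_le (hX : X.Connected) {δ : ℕ} (hδ : FourPoint X δ)
    {α γ : GeodesicRay X} (h : Asymptotic γ α) (n : ℕ) :
    ∀ᶠ M in Filter.atTop, X.dist (γ.toFun n) (α.toFun M) + n ≤
      X.dist (γ.toFun 0) (α.toFun M) + δ := by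
  obtain ⟨L, hL⟩ : ∃ L, L = X.dist (γ.toFun 0) (α.toFun 0) := ⟨_, rfl⟩
  filter_upwards [Filter.eventually_ge_atTop (2 * n + 2 * (2 * δ + L) + δ + 1)] with M hM
  have tri := fun u v w => hX.dist_triangle (u := u) (v := v) (w := w)
  have h₁ := h.dist_le hX hδ M
  have e₁ := γ.dist_eq (m := 0) (n := M) (by omega)
  have e₂ := γ.dist_eq' (m := 0) (n := n) (by omega)
  have e₃ := γ.dist_eq (m := n) (n := M) (by omega)
  have c₁ := X.dist_comm (u := α.toFun M) (v := γ.toFun 0)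
  have c₂ := X.dist_comm (u := α.toFun M) (v := γ.toFun M)
  have t := tri (γ.toFun n) (α.toFun M) (γ.toFun M)
  have f := hδ (γ.toFun n) (α.toFun M) (γ.toFun 0) (γ.toFun M)
  omega

end GeodesicRay

/-- The centre is the point of `[p 0, p 1]` whose distance to `p 0` is the Gromov product of `p 1`
and `p 2` at `p 0`. It balances the two terms of the maximum; the `2` absorbs rounding. -/
theorem FourPoint.exists_center (hX : X.Connected) {δ : ℕ} (hδ : FourPoint X δ)
    (p : Fin 3 → V) : ∃ v, ∀ i j, i ≠ j →
      X.dist v (p i) + X.dist v (p j) ≤ X.dist (p i) (p j) + (δ + 2) := by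
  have tri := fun u v w => hX.dist_triangle (u := u) (v := v) (w := w)
  have c₁ := X.dist_comm (u := p 1) (v := p 0)
  have c₂ := X.dist_comm (u := p 2) (v := p 0)
  have c₃ := X.dist_comm (u := p 2) (v := p 1)
  have t₁ := tri (p 0) (p 1) (p 2)
  have t₂ := tri (p 0) (p 2) (p 1)
  have t₃ := tri (p 1) (p 0) (p 2)
  obtain ⟨v, hv₀, hv₁⟩ := exists_dist_eq hX (x := p 0) (y := p 1)
    (k := (X.dist (p 0) (p 1) + X.dist (p 0) (p 2) - X.dist (p 1) (p 2)) / 2) (by omega)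
  refine ⟨v, ?_⟩
  have c₄ := X.dist_comm (u := p 0) (v := v)
  have c₅ := X.dist_comm (u := p 1) (v := v)
  have f := hδ v (p 2) (p 0) (p 1)
  have h₀₁ : X.dist v (p 0) + X.dist v (p 1) ≤ X.dist (p 0) (p 1) + (δ + 2) := by omega
  have h₀₂ : X.dist v (p 0) + X.dist v (p 2) ≤ X.dist (p 0) (p 2) + (δ + 2) := by omega
  have h₁₂ : X.dist v (p 1) + X.dist v (p 2) ≤ X.dist (p 1) (p 2) + (δ + 2) := by omega
  intro i j hij
  fin_cases i <;> fin_cases j <;> first | exact absurd rfl hij | skip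
  all_goals simp only [Fin.zero_eta, Fin.mk_one, Fin.reduceFinMk] at *; omega

/-- Three rays from a common origin which pairwise diverge have a vertex from which all asymptotic
rays diverge after a uniform time. -/
theorem FourPoint.exists_ray_center (hX : X.Connected) {δ : ℕ} (hδ : FourPoint X δ)
    (α : Fin 3 → GeodesicRay X) (h0 : ∀ i j, (α i).toFun 0 = (α j).toFun 0)
    (hα : ∀ i j, i ≠ j → ¬ GeodesicRay.Asymptotic (α i) (α j)) :
    ∃ v, ∀ γ : Fin 3 → GeodesicRay X, (∀ i, (γ i).toFun 0 = v) →
      (∀ i, GeodesicRay.Asymptotic (γ i) (α i)) → ∀ i j, i ≠ j →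
        2 * δ < X.dist ((γ i).toFun (3 * δ + 2)) ((γ j).toFun (3 * δ + 2)) := by
  obtain ⟨N, hN⟩ : ∃ N, ∀ i j, i ≠ j → ∀ M ≥ N,
      X.dist ((α i).toFun M) ((α j).toFun M) =
        X.dist ((α i).toFun N) ((α j).toFun N) + 2 * (M - N) := by
    refine Filter.Eventually.exists (f := Filter.atTop) ?_
    simp only [Filter.eventually_all]
    exact fun i j hij => GeodesicRay.eventually_dist_eq_add hX hδ (h0 i j) (hα i j hij)
  obtain ⟨v, hv⟩ := hδ.exists_center hX fun i => (α i).toFun N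
  refine ⟨v, fun γ hγ hγα i j hij => ?_⟩
  -- Past `N` the distances grow at full speed, so `v` is a centre at time `M` with the same error
  -- `δ + 2`. Following `γ` for time `T` gains `T - δ` towards each target, so the rays are at least
  -- `2 * T - 3 * δ - 2` apart, which is `3 * δ + 2` for `T = 3 * δ + 2`.
  obtain ⟨M, hMN, hMi, hMj⟩ := ((Filter.eventually_ge_atTop N).and
    (((hγα i).eventually_dist_add_le hX hδ (3 * δ + 2)).and
      ((hγα j).eventually_dist_add_le hX hδ (3 * δ + 2)))).exists
  have tri := fun u v w => hX.dist_triangle (u := u) (v := v) (w := w)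
  have h₁ := hN i j hij M hMN
  have h₂ := hv i j hij
  rw [hγ] at hMi hMj
  have e₁ := (α i).dist_eq hMN
  have e₂ := (α j).dist_eq hMN
  have t₁ := tri v ((α i).toFun N) ((α i).toFun M)
  have t₂ := tri v ((α j).toFun N) ((α j).toFun M)
  have t₃ := tri ((α i).toFun M) ((γ i).toFun (3 * δ + 2)) ((α j).toFun M)
  have t₄ := tri ((γ i).toFun (3 * δ + 2)) ((γ j).toFun (3 * δ + 2)) ((α j).toFun M)
  have c₁ := X.dist_comm (u := (α i).toFun M) (v := (γ i).toFun (3 * δ + 2))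
  omega

/-- Two vertices from each of which rays to the same three boundary points diverge fast are close
to each other. -/
theorem FourPoint.dist_ray_center_le (hX : X.Connected) {δ : ℕ} (hδ : FourPoint X δ)
    {D : ℕ} {v w : V} {α β : Fin 3 → GeodesicRay X} (hα : ∀ i, (α i).toFun 0 = v)
    (hβ : ∀ i, (β i).toFun 0 = w) (hαβ : ∀ i, GeodesicRay.Asymptotic (α i) (β i))
    (hαD : ∀ i j, i ≠ j → ∃ n ≤ D, 2 * δ < X.dist ((α i).toFun n) ((α j).toFun n))
    (hβD : ∀ i j, i ≠ j → ∃ n ≤ D, 2 * δ < X.dist ((β i).toFun n) ((β j).toFun n)) :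
    X.dist v w ≤ 10 * D + 16 * δ := by
  have tri := fun u v w => hX.dist_triangle (u := u) (v := v) (w := w)
  obtain ⟨L, hL⟩ : ∃ L, L = X.dist v w := ⟨_, rfl⟩
  obtain ⟨M, hM⟩ : ∃ M, M = 10 * (D + δ + L + 1) := ⟨_, rfl⟩
  have hv : ∀ i, X.dist v ((α i).toFun M) = M := fun i => by
    have := (α i).dist_eq (m := 0) (n := M) (by omega)
    rw [hα] at this
    omega
  have hw : ∀ i, X.dist w ((β i).toFun M) = M := fun i => by
    have := (β i).dist_eq (m := 0) (n := M) (by omega)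
    rw [hβ] at this
    omega
  have hκ : ∀ i, X.dist ((α i).toFun M) ((β i).toFun M) ≤ 2 * δ + L := fun i => by
    have := (hαβ i).dist_le hX hδ M
    rwa [hα, hβ, ← hL] at this
  have hvD : ∀ i j, i ≠ j → 2 * M ≤ X.dist ((α i).toFun M) ((α j).toFun M) + 2 * D + δ :=
    fun i j hij => by
      obtain ⟨n, hn, h⟩ := hαD i j hij
      exact GeodesicRay.two_mul_le_dist_add hX hδ (by rw [hα, hα]) hn h M
  have hwD : ∀ i j, i ≠ j → 2 * M ≤ X.dist ((β i).toFun M) ((β j).toFun M) + 2 * D + δ :=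
    fun i j hij => by
      obtain ⟨n, hn, h⟩ := hβD i j hij
      exact GeodesicRay.two_mul_le_dist_add hX hδ (by rw [hβ, hβ]) hn h M
  -- `w` is a coarse centre for the `β i` at time `M`; this moves the property to the `α i`.
  have key : ∀ i j, i ≠ j → X.dist w ((α i).toFun M) + X.dist w ((α j).toFun M) ≤
      X.dist ((α i).toFun M) ((α j).toFun M) + 2 * D + 3 * δ := by
    intro i j hij
    have h₁ := hw i
    have h₂ := hw j
    have h₃ := hκ i
    have h₄ := hκ j
    have h₅ := hwD i j hij
    have h₆ := hv i
    have h₇ := hv j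
    have t₁ := tri v w ((α i).toFun M)
    have t₂ := tri v w ((α j).toFun M)
    have t₃ := tri w ((β i).toFun M) ((α i).toFun M)
    have c₁ := X.dist_comm (u := (α i).toFun M) (v := (β i).toFun M)
    have c₂ := X.dist_comm (u := (α i).toFun M) (v := (α j).toFun M)
    have c₃ := X.dist_comm (u := (α i).toFun M) (v := (β j).toFun M)
    have c₄ := X.dist_comm (u := (α i).toFun M) (v := w)
    have c₅ := X.dist_comm (u := (α j).toFun M) (v := w)
    have c₆ := X.dist_comm (u := (β i).toFun M) (v := w)
    have c₇ := X.dist_comm (u := (β j).toFun M) (v := w)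
    have f₁ := hδ w ((α i).toFun M) ((β i).toFun M) ((β j).toFun M)
    have f₂ := hδ w ((α j).toFun M) ((β j).toFun M) ((α i).toFun M)
    omega
  -- The third ray is needed here: two targets only put `w` near a line, while three pairwise sums
  -- bound each distance from `w` by `M` plus a constant.
  have f := hδ v w ((α 0).toFun M) ((α 1).toFun M)
  have k₀₁ := key 0 1 (by decide)
  have k₀₂ := key 0 2 (by decide)
  have k₁₂ := key 1 2 (by decide)
  have d₀₁ := hvD 0 1 (by decide)
  have d₀₂ := hvD 0 2 (by decide)
  have d₁₂ := hvD 1 2 (by decide)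
  have h₀ := hv 0
  have h₁ := hv 1
  have h₂ := hv 2
  have t₁ := tri ((α 0).toFun M) v ((α 1).toFun M)
  have t₂ := tri ((α 0).toFun M) v ((α 2).toFun M)
  have t₃ := tri ((α 1).toFun M) v ((α 2).toFun M)
  have t₄ := tri ((α 0).toFun M) w ((α 1).toFun M)
  have t₅ := tri ((α 0).toFun M) w ((α 2).toFun M)
  have t₆ := tri ((α 1).toFun M) w ((α 2).toFun M)
  have c₀ := X.dist_comm (u := (α 0).toFun M) (v := v)
  have c₁ := X.dist_comm (u := (α 1).toFun M) (v := v)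
  have c₂ := X.dist_comm (u := (α 2).toFun M) (v := v)
  have c₃ := X.dist_comm (u := (α 0).toFun M) (v := w)
  have c₄ := X.dist_comm (u := (α 1).toFun M) (v := w)
  have c₅ := X.dist_comm (u := (α 2).toFun M) (v := w)
  omega

end Rays

/-- The saturation of a closed set is the projection, along a compact factor, of a closed part of
the relation. -/
theorem isProperMap_of_isClosed_setOf_eq {R : Type*} {Z : Type*} [TopologicalSpace R]
    [CompactSpace R] [TopologicalSpace Z] {q : R → Z} (hq : Topology.IsQuotientMap q)
    (h : IsClosed {p : R × R | q p.1 = q p.2}) : IsProperMap q := by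
  rw [isProperMap_iff_isClosedMap_and_compact_fibers]
  refine ⟨hq.continuous, fun C hC => ?_, fun z => ?_⟩
  · rw [← hq.isClosed_preimage]
    have := isClosedMap_snd_of_compactSpace _ (h.inter (hC.preimage continuous_fst))
    refine (congrArg IsClosed (Set.ext fun b => ?_)).mp this
    constructor
    · rintro ⟨⟨a, b⟩, ⟨hab, ha⟩, rfl⟩
      exact ⟨a, ha, hab⟩
    · rintro ⟨a, ha, hab⟩
      exact ⟨(a, b), ⟨hab, ha⟩, rfl⟩
  · obtain ⟨a, rfl⟩ := hq.surjective z
    refine IsClosed.isCompact ?_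
    have := h.preimage (f := fun b : R => (b, a)) (by fun_prop)
    exact this

theorem t2Space_of_isProperMap {R : Type*} {Z : Type*} [TopologicalSpace R]
    [TopologicalSpace Z] {q : R → Z} (hq : IsProperMap q) (hs : Function.Surjective q)
    (h : IsClosed {p : R × R | q p.1 = q p.2}) : T2Space Z := by
  rw [t2_iff_isClosed_diagonal]
  refine (congrArg IsClosed (Set.ext fun p => ?_)).mp ((hq.prodMap hq).isClosedMap _ h)
  constructor
  · rintro ⟨⟨a, b⟩, hab, rfl⟩
    exact hab
  · obtain ⟨y, z⟩ := p
    rintro (rfl : y = z)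
    obtain ⟨a, rfl⟩ := hs y
    exact ⟨(a, a), rfl, rfl⟩

/-! ### The topology of the boundary and of its triples -/

section BoundaryTopology

variable {V : Type v}

/-- The geodesic rays that start at `x₀`. -/
abbrev RaysFrom (X : SimpleGraph V) (x₀ : V) : Type v :=
  {α : GeodesicRay X // α.toFun 0 = x₀}

variable {X : SimpleGraph V} {x₀ : V}

/-- The boundary point of a ray that starts at `x₀`. -/
def endpoint (α : RaysFrom X x₀) : GromovBoundary X x₀ := GromovBoundary.mk x₀ α.1

theorem GromovBoundary.mk_eq_mk {α β : GeodesicRay X} :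
    GromovBoundary.mk x₀ α = GromovBoundary.mk x₀ β ↔ GeodesicRay.Asymptotic α β :=
  Quotient.eq (r := GeodesicRay.asymptoticSetoid X)

section Discrete

variable [TopologicalSpace V] [DiscreteTopology V]

theorem GeodesicRay.isInducing_toFun :
    Topology.IsInducing (GeodesicRay.toFun : GeodesicRay X → ℕ → V) := by
  refine ⟨?_⟩
  have h := DiscreteTopology.eq_bot (α := V)
  subst h
  rfl

theorem RaysFrom.continuous_eval (n : ℕ) :
    Continuous fun α : RaysFrom X x₀ => α.1.toFun n :=
  (continuous_apply n).comp (GeodesicRay.isInducing_toFun.continuous.comp continuous_subtype_val)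

theorem continuous_dist {T : Type*} [TopologicalSpace T] (X : SimpleGraph V) {f g : T → V}
    (hf : Continuous f) (hg : Continuous g) : Continuous fun t => X.dist (f t) (g t) :=
  (continuous_of_discreteTopology (f := fun p : V × V => X.dist p.1 p.2)).comp (hf.prodMk hg)

end Discrete

/-- The rays form a closed subset of a product of finite balls, so Tychonoff applies. -/
theorem RaysFrom.compactSpace (hX : X.Connected) (hfin : ∀ a, (X.neighborSet a).Finite) :
    CompactSpace (RaysFrom X x₀) := by
  let _ : TopologicalSpace V := ⊥
  have _ : DiscreteTopology V := ⟨rfl⟩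
  have hind : Topology.IsInducing fun α : RaysFrom X x₀ => α.1.toFun :=
    GeodesicRay.isInducing_toFun.comp Topology.IsInducing.subtypeVal
  rw [← isCompact_univ_iff, hind.isCompact_iff]
  have hcomp : IsCompact (Set.pi univ fun n => {y | X.dist x₀ y ≤ n}) :=
    isCompact_univ_pi fun n => (finite_ball hX hfin x₀ n).isCompact
  refine hcomp.of_isClosed_subset ?_ ?_
  · have hcl : IsClosed {f : ℕ → V | f 0 = x₀ ∧ ∀ m n, X.edist (f m) (f (m + n)) = n} := by
      have hedist : IsClosed {f : ℕ → V | ∀ m n, X.edist (f m) (f (m + n)) = n} := by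
        simp only [ofPred_forall]
        refine isClosed_iInter fun m => isClosed_iInter fun n => ?_
        exact (isClosed_discrete {p : V × V | X.edist p.1 p.2 = n}).preimage
          (f := fun f : ℕ → V => (f m, f (m + n))) (by fun_prop)
      exact (isClosed_eq (continuous_apply 0) continuous_const).inter hedist
    refine (congrArg IsClosed (Set.ext fun f => ?_)).mp hcl
    constructor
    · rintro ⟨h0, h⟩
      exact ⟨⟨⟨f, h⟩, h0⟩, mem_univ _, rfl⟩
    · rintro ⟨α, -, rfl⟩
      exact ⟨α.2, α.1.edist_eq⟩
  · rintro _ ⟨α, -, rfl⟩ n -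
    have := α.1.dist_eq (m := 0) (n := n) (by omega)
    rw [α.2] at this
    change X.dist x₀ (α.1.toFun n) ≤ n
    omega

variable {δ : ℕ}

theorem surjective_endpoint (hX : X.Connected) (hfin : ∀ a, (X.neighborSet a).Finite)
    (hδ : FourPoint X δ) : Function.Surjective (endpoint : RaysFrom X x₀ → _) := by
  intro ξ
  obtain ⟨α, rfl⟩ := Quotient.exists_rep ξ
  obtain ⟨β, h0, hβ⟩ := GeodesicRay.exists_asymptotic hX hfin hδ α x₀
  exact ⟨⟨β, h0⟩, GromovBoundary.mk_eq_mk.2 hβ⟩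

theorem isQuotientMap_endpoint (hX : X.Connected) (hfin : ∀ a, (X.neighborSet a).Finite)
    (hδ : FourPoint X δ) : Topology.IsQuotientMap (endpoint : RaysFrom X x₀ → _) :=
  ⟨⟨rfl⟩, surjective_endpoint hX hfin hδ⟩

theorem endpoint_eq_iff (hX : X.Connected) (hδ : FourPoint X δ) {α β : RaysFrom X x₀} :
    endpoint α = endpoint β ↔ ∀ n, X.dist (α.1.toFun n) (β.1.toFun n) ≤ 2 * δ := by
  refine GromovBoundary.mk_eq_mk.trans ⟨fun h n => ?_, GeodesicRay.asymptotic_of_dist_le hX⟩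
  simpa [α.2, β.2] using h.dist_le hX hδ n

theorem isClosed_setOf_endpoint_eq (hX : X.Connected) (hδ : FourPoint X δ) :
    IsClosed {p : RaysFrom X x₀ × RaysFrom X x₀ | endpoint p.1 = endpoint p.2} := by
  let _ : TopologicalSpace V := ⊥
  have _ : DiscreteTopology V := ⟨rfl⟩
  simp only [endpoint_eq_iff hX hδ, ofPred_forall]
  exact isClosed_iInter fun n => isClosed_le (continuous_dist X
    ((RaysFrom.continuous_eval n).comp continuous_fst)
    ((RaysFrom.continuous_eval n).comp continuous_snd)) continuous_const

theorem isProperMap_endpoint (hX : X.Connected) (hfin : ∀ a, (X.neighborSet a).Finite)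
    (hδ : FourPoint X δ) : IsProperMap (endpoint : RaysFrom X x₀ → _) :=
  have _ := RaysFrom.compactSpace (x₀ := x₀) hX hfin
  isProperMap_of_isClosed_setOf_eq (isQuotientMap_endpoint hX hfin hδ)
    (isClosed_setOf_endpoint_eq hX hδ)

theorem GromovBoundary.t2Space (hX : X.Connected) (hfin : ∀ a, (X.neighborSet a).Finite)
    (hδ : FourPoint X δ) : T2Space (GromovBoundary X x₀) :=
  t2Space_of_isProperMap (isProperMap_endpoint hX hfin hδ) (surjective_endpoint hX hfin hδ)
    (isClosed_setOf_endpoint_eq hX hδ)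

theorem GromovBoundary.compactSpace (hX : X.Connected) (hfin : ∀ a, (X.neighborSet a).Finite)
    (hδ : FourPoint X δ) : CompactSpace (GromovBoundary X x₀) :=
  have _ := RaysFrom.compactSpace (x₀ := x₀) hX hfin
  (surjective_endpoint hX hfin hδ).compactSpace (isQuotientMap_endpoint hX hfin hδ).continuous

/-- The triples such that any two rays from `x₀` to distinct entries are far apart at some time
up to `D`. -/
def divergingTriples (X : SimpleGraph V) (x₀ : V) (δ D : ℕ) :
    Set (OrderedTriple (GromovBoundary X x₀)) :=
  {t | ∀ i j, i ≠ j → ∀ α β : RaysFrom X x₀, endpoint α = t.1 i → endpoint β = t.1 j →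
    ∃ n ≤ D, 2 * δ < X.dist (α.1.toFun n) (β.1.toFun n)}

/-- Quantifying over all representing rays makes this work: failure for a given pair of entries is
the image, under a proper map, of the closed set of pairs of rays that stay close up to `D`. -/
theorem isOpen_divergingTriples (hX : X.Connected) (hfin : ∀ a, (X.neighborSet a).Finite)
    (hδ : FourPoint X δ) (D : ℕ) : IsOpen (divergingTriples X x₀ δ D) := by
  let _ : TopologicalSpace V := ⊥
  have _ : DiscreteTopology V := ⟨rfl⟩
  have hq := isProperMap_endpoint (x₀ := x₀) hX hfin hδ
  have hcl : IsClosed {p : RaysFrom X x₀ × RaysFrom X x₀ |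
      ∀ n, n ≤ D → X.dist (p.1.1.toFun n) (p.2.1.toFun n) ≤ 2 * δ} := by
    simp only [ofPred_forall]
    exact isClosed_iInter fun n => isClosed_iInter fun _ => isClosed_le (continuous_dist X
      ((RaysFrom.continuous_eval n).comp continuous_fst)
      ((RaysFrom.continuous_eval n).comp continuous_snd)) continuous_const
  have himg := ((hq.prodMap hq).isClosedMap _ hcl).isOpen_compl
  have : IsOpen (⋂ i : Fin 3, ⋂ j : Fin 3, ⋂ _ : i ≠ j,
      (fun t : OrderedTriple (GromovBoundary X x₀) => (t.1 i, t.1 j)) ⁻¹'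
        (Prod.map endpoint endpoint '' {p : RaysFrom X x₀ × RaysFrom X x₀ |
          ∀ n, n ≤ D → X.dist (p.1.1.toFun n) (p.2.1.toFun n) ≤ 2 * δ})ᶜ) :=
    isOpen_iInter_of_finite fun i => isOpen_iInter_of_finite fun j =>
      isOpen_iInter_of_finite fun _ => himg.preimage
        (((continuous_apply i).comp continuous_subtype_val).prodMk
          ((continuous_apply j).comp continuous_subtype_val))
  refine (congrArg IsOpen (Set.ext fun t => ?_)).mp this
  simp only [mem_iInter, mem_preimage, mem_compl_iff, divergingTriples]
  refine forall_congr' fun i => forall_congr' fun j => forall_congr' fun _ => ?_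
  constructor
  · intro h α β hα hβ
    by_contra! hcon
    exact h ⟨(α, β), hcon, Prod.ext hα hβ⟩
  · rintro h ⟨⟨α, β⟩, hαβ, heq⟩
    obtain ⟨n, hn, hlt⟩ := h α β (congrArg Prod.fst heq) (congrArg Prod.snd heq)
    exact absurd (hαβ n hn) (by simpa using hlt)

theorem divergingTriples_mono : Monotone (divergingTriples X x₀ δ) := by
  intro D D' hD t ht i j hij α β hα hβ
  obtain ⟨n, hn, h⟩ := ht i j hij α β hα hβ
  exact ⟨n, hn.trans hD, h⟩

theorem mem_divergingTriples_of_setoid {D : ℕ} {s t : OrderedTriple (GromovBoundary X x₀)}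
    (hst : (tripleSetoid _).r s t) (hs : s ∈ divergingTriples X x₀ δ D) :
    t ∈ divergingTriples X x₀ δ D := by
  obtain ⟨σ, hσ⟩ := hst
  intro i j hij α β hα hβ
  exact hs (σ i) (σ j) (σ.injective.ne hij) α β (hα.trans (hσ i)) (hβ.trans (hσ j))

theorem exists_mem_divergingTriples (hX : X.Connected) (hfin : ∀ a, (X.neighborSet a).Finite)
    (hδ : FourPoint X δ) (t : OrderedTriple (GromovBoundary X x₀)) :
    ∃ D, t ∈ divergingTriples X x₀ δ D := by
  choose α hα using fun i => surjective_endpoint (x₀ := x₀) hX hfin hδ (t.1 i)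
  -- The surplus `4 * δ` pays for replacing both chosen rays by arbitrary representatives, at `2 *
  -- δ` each.
  have hfar : ∀ i j, i ≠ j → ∃ n,
      2 * δ + 4 * δ < X.dist ((α i).1.toFun n) ((α j).1.toFun n) := fun i j hij =>
    GeodesicRay.exists_lt_dist_of_not_asymptotic hX (fun h => hij (t.2 (by
      rw [← hα, ← hα]
      exact GromovBoundary.mk_eq_mk.2 h))) _
  obtain ⟨D, hD⟩ : ∃ D, ∀ i j, i ≠ j → ∃ n ≤ D,
      2 * δ + 4 * δ < X.dist ((α i).1.toFun n) ((α j).1.toFun n) := by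
    refine Filter.Eventually.exists (f := Filter.atTop) ?_
    simp only [Filter.eventually_all]
    intro i j hij
    obtain ⟨n, hn⟩ := hfar i j hij
    filter_upwards [Filter.eventually_ge_atTop n] with D hD using ⟨n, hD, hn⟩
  refine ⟨D, fun i j hij β γ hβ hγ => ?_⟩
  obtain ⟨n, hn, h⟩ := hD i j hij
  refine ⟨n, hn, ?_⟩
  have h₁ := (endpoint_eq_iff hX hδ).1 ((hα i).trans hβ.symm) n
  have h₂ := (endpoint_eq_iff hX hδ).1 (hγ.trans (hα j).symm) n
  have t₁ := hX.dist_triangle (u := (α i).1.toFun n) (v := β.1.toFun n) (w := (α j).1.toFun n)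
  have t₂ := hX.dist_triangle (u := β.1.toFun n) (v := γ.1.toFun n) (w := (α j).1.toFun n)
  omega

/-- A compact set of unordered triples consists of uniformly diverging triples. -/
theorem exists_subset_image_divergingTriples (hX : X.Connected)
    (hfin : ∀ a, (X.neighborSet a).Finite) (hδ : FourPoint X δ)
    {K : Set (DistinctTriples (GromovBoundary X x₀))} (hK : IsCompact K) :
    ∃ D, K ⊆ Quotient.mk (tripleSetoid _) '' divergingTriples X x₀ δ D := by
  refine hK.elim_directed_cover
    (fun D => Quotient.mk (tripleSetoid _) '' divergingTriples X x₀ δ D) (fun D => ?_) ?_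
    (Monotone.directed_le fun D D' h => image_mono (divergingTriples_mono h))
  · change IsOpen (Quotient.mk (tripleSetoid (GromovBoundary X x₀)) ⁻¹' _)
    refine (congrArg IsOpen (Set.ext fun t => ?_)).mp (isOpen_divergingTriples hX hfin hδ D)
    constructor
    · intro ht
      exact ⟨t, ht, rfl⟩
    · rintro ⟨s, hs, hst⟩
      exact mem_divergingTriples_of_setoid (Quotient.exact hst) hs
  · intro k _
    obtain ⟨t, rfl⟩ := Quotient.exists_rep k
    obtain ⟨D, hD⟩ := exists_mem_divergingTriples hX hfin hδ t
    exact mem_iUnion.2 ⟨D, t, hD, rfl⟩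

end BoundaryTopology

/-! ### The action on the boundary and on triples -/

section BoundaryAction

variable {G : Type u} [Group G] [TopologicalSpace G]
  {V : Type v} [MulAction G V] {X : SimpleGraph V} [hX : IsCayleyAbelsGraph G X] {x₀ : V} {δ : ℕ}

theorem smul_endpoint_eq_iff (hδ : FourPoint X δ) {g : G} {α β : RaysFrom X x₀} :
    g • endpoint α = endpoint β ↔
      ∀ n, X.dist (g • α.1.toFun n) (β.1.toFun n) ≤ 2 * δ + X.dist (g • x₀) x₀ := by
  refine GromovBoundary.mk_eq_mk.trans
    ⟨fun h n => ?_, GeodesicRay.asymptotic_of_dist_le (α := g • α.1) hX.connected⟩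
  simpa [GeodesicRay.smul_toFun, α.2, β.2] using h.dist_le hX.connected hδ n

/-- The relation "`g` sends the endpoint of `α` to that of `β`" is closed in `(g, α, β)`. The
preimage of a closed set is the image of a closed part of it under a proper map, as `β` ranges over
a compact space. -/
theorem GromovBoundary.continuousSMul [IsTopologicalGroup G] (hδ : FourPoint X δ) :
    ContinuousSMul G (GromovBoundary X x₀) := by
  let _ : TopologicalSpace V := ⊥
  have _ : DiscreteTopology V := ⟨rfl⟩
  have _ := continuousSMul_vertex (G := G) X
  have _ := RaysFrom.compactSpace (x₀ := x₀) hX.connected hX.finite_neighborSet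
  have hq := isProperMap_endpoint (x₀ := x₀) hX.connected hX.finite_neighborSet hδ
  have hsurj := surjective_endpoint (x₀ := x₀) hX.connected hX.finite_neighborSet hδ
  have hcl : IsClosed {p : G × RaysFrom X x₀ × RaysFrom X x₀ |
      p.1 • endpoint p.2.1 = endpoint p.2.2} := by
    simp only [smul_endpoint_eq_iff hδ, ofPred_forall]
    refine isClosed_iInter fun n => isClosed_le (continuous_dist X ?_ ?_)
      (continuous_const.add (continuous_dist X ?_ continuous_const))
    · exact continuous_fst.smul
        ((RaysFrom.continuous_eval n).comp (continuous_fst.comp continuous_snd))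
    · exact (RaysFrom.continuous_eval n).comp (continuous_snd.comp continuous_snd)
    · exact continuous_fst.smul continuous_const
  have hproper : IsProperMap
      (Prod.map id (endpoint ∘ Prod.fst) :
        G × RaysFrom X x₀ × RaysFrom X x₀ → G × GromovBoundary X x₀) :=
    isProperMap_id.prodMap (hq.comp isProperMap_fst_of_compactSpace)
  refine ⟨continuous_iff_isClosed.2 fun F hF => ?_⟩
  have hF' : IsClosed {p : G × RaysFrom X x₀ × RaysFrom X x₀ | endpoint p.2.2 ∈ F} :=
    hF.preimage (hq.continuous.comp (continuous_snd.comp continuous_snd))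
  refine (congrArg IsClosed (Set.ext fun p => ?_)).mp
    (hproper.isClosedMap _ (hcl.inter hF'))
  constructor
  · rintro ⟨⟨g, α, β⟩, ⟨h₁, h₂⟩, rfl⟩
    change g • endpoint α ∈ F
    have h₁ : g • endpoint α = endpoint β := h₁
    rw [h₁]
    exact h₂
  · obtain ⟨g, ξ⟩ := p
    intro hp
    obtain ⟨α, rfl⟩ := hsurj ξ
    obtain ⟨β, hβ⟩ := hsurj (g • endpoint α)
    refine ⟨(g, α, β), ⟨hβ.symm, ?_⟩, rfl⟩
    change endpoint β ∈ F
    rw [hβ]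
    exact hp

theorem isProperAction_distinctTriples [IsTopologicalGroup G] (hδ : FourPoint X δ) :
    IsProperAction G (DistinctTriples (GromovBoundary X x₀)) := by
  intro K hK
  have hsurj := surjective_endpoint (x₀ := x₀) hX.connected hX.finite_neighborSet hδ
  obtain ⟨D, hD⟩ :=
    exists_subset_image_divergingTriples hX.connected hX.finite_neighborSet hδ hK
  refine (isCompact_setOf_dist_smul_le (G := G) X x₀ (10 * D + 16 * δ)).closure_of_subset ?_
  rintro g ⟨_, ⟨k, hk, rfl⟩, hgk⟩
  obtain ⟨t, ht, rfl⟩ := hD hk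
  obtain ⟨s, hs, hst⟩ := hD hgk
  have hgt : g • t ∈ divergingTriples X x₀ δ D :=
    mem_divergingTriples_of_setoid (Quotient.exact (s := tripleSetoid _) hst) hs
  choose α hα using fun i => hsurj (t.1 i)
  choose β hβ using fun i => hsurj ((g • t).1 i)
  -- Both `x₀` and `g • x₀` are centres of `g • t`: the former as `g • t` is diverging, the latter
  -- by translating the rays to `t`.
  refine hδ.dist_ray_center_le hX.connected (D := D) (α := fun i => (β i).1)
    (β := fun i => g • (α i).1) (fun i => (β i).2) (fun i => ?_) (fun i => ?_)
    (fun i j hij => hgt i j hij _ _ (hβ i) (hβ j)) (fun i j hij => ?_)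
  · rw [GeodesicRay.smul_toFun, (α i).2]
  · rw [← GromovBoundary.mk_eq_mk (x₀ := x₀), ← GromovBoundary.smul_mk]
    refine (hβ i).trans ?_
    change g • t.1 i = g • endpoint (α i)
    rw [hα]
  · obtain ⟨n, hn, h⟩ := ht i j hij _ _ (hα i) (hα j)
    refine ⟨n, hn, ?_⟩
    rwa [GeodesicRay.smul_toFun, GeodesicRay.smul_toFun, dist_smul]

theorem isCocompactAction_distinctTriples (hδ : FourPoint X δ) :
    IsCocompactAction G (DistinctTriples (GromovBoundary X x₀)) := by
  let _ : TopologicalSpace V := ⊥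
  have _ : DiscreteTopology V := ⟨rfl⟩
  have _ := RaysFrom.compactSpace (x₀ := x₀) hX.connected hX.finite_neighborSet
  have hq := isProperMap_endpoint (x₀ := x₀) hX.connected hX.finite_neighborSet hδ
  have hsurj := surjective_endpoint (x₀ := x₀) hX.connected hX.finite_neighborSet hδ
  -- `S` consists of the ray triples for which `x₀` is a centre with the uniform time; being more
  -- than `2 * δ` apart makes their endpoints distinct.
  let S : Set (Fin 3 → RaysFrom X x₀) := {α | ∀ i j, i ≠ j →
    2 * δ + 1 ≤ X.dist ((α i).1.toFun (3 * δ + 2)) ((α j).1.toFun (3 * δ + 2))}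
  have hS : IsClosed S := by
    simp only [S, ofPred_forall]
    exact isClosed_iInter fun i => isClosed_iInter fun j => isClosed_iInter fun _ =>
      isClosed_le continuous_const (continuous_dist X
        ((RaysFrom.continuous_eval _).comp (continuous_apply i))
        ((RaysFrom.continuous_eval _).comp (continuous_apply j)))
  have _ : CompactSpace S := isCompact_iff_compactSpace.1 hS.isCompact
  have hinj : ∀ α ∈ S, Function.Injective fun i => endpoint (α i) := by
    intro α hα i j hij
    by_contra hne
    have h₁ := hα i j hne
    have h₂ := (endpoint_eq_iff hX.connected hδ).1 hij (3 * δ + 2)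
    omega
  let f : S → OrderedTriple (GromovBoundary X x₀) := fun α =>
    ⟨fun i => endpoint (α.1 i), hinj α.1 α.2⟩
  have hf : Continuous f := Continuous.subtype_mk (continuous_pi fun i =>
    hq.continuous.comp ((continuous_apply i).comp continuous_subtype_val)) _
  have hπ : Continuous (fun t => Quotient.mk (tripleSetoid _) t :
      OrderedTriple (GromovBoundary X x₀) → DistinctTriples (GromovBoundary X x₀)) :=
    continuous_quotient_mk'
  refine ⟨_, isCompact_range (hπ.comp hf), eq_univ_of_forall fun k => ?_⟩
  obtain ⟨t, rfl⟩ := Quotient.exists_rep k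
  choose α hα using fun i => hsurj (t.1 i)
  obtain ⟨v, hv⟩ := hδ.exists_ray_center hX.connected (fun i => (α i).1)
    (fun i j => (α i).2.trans (α j).2.symm) fun i j hij h => hij (t.2 (by
      rw [← hα, ← hα]
      exact GromovBoundary.mk_eq_mk.2 h))
  choose γ hγ₀ hγ using fun i => GeodesicRay.exists_asymptotic hX.connected
    hX.finite_neighborSet hδ (α i).1 v
  obtain ⟨g, rfl⟩ := hX.isPretransitive.exists_smul_eq x₀ v
  have hfar := hv γ hγ₀ hγ
  let β : Fin 3 → RaysFrom X x₀ := fun i => ⟨g⁻¹ • γ i, by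
    rw [GeodesicRay.smul_toFun, hγ₀, inv_smul_smul]⟩
  have hβ : β ∈ S := fun i j hij => by
    change 2 * δ + 1 ≤ X.dist (g⁻¹ • (γ i).toFun _) (g⁻¹ • (γ j).toFun _)
    rw [dist_smul]
    exact hfar i j hij
  refine mem_iUnion.2 ⟨g, Quotient.mk (tripleSetoid _) (f ⟨β, hβ⟩), ⟨⟨β, hβ⟩, rfl⟩, ?_⟩
  change Quotient.mk (tripleSetoid _) (g • f ⟨β, hβ⟩) = _
  refine congrArg _ (Subtype.ext (funext fun i => ?_))
  change g • GromovBoundary.mk x₀ (g⁻¹ • γ i) = t.1 i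
  rw [GromovBoundary.smul_mk, smul_inv_smul, ← hα]
  exact GromovBoundary.mk_eq_mk.2 (hγ i)

end BoundaryAction

end TDLC

/-- A hyperbolic TDLC group acts as a uniform convergence group on its Gromov boundary, the latter
being computed in an arbitrary Cayley–Abels graph `X`, with an arbitrary base vertex. -/
theorem proposition2p12 {G : Type u} [Group G] [TopologicalSpace G] [IsTopologicalGroup G]
    [T2Space G] [LocallyCompactSpace G] [TotallyDisconnectedSpace G]
    (hG : TDLC.IsHyperbolicGroup G)
    {V : Type v} [MulAction G V] (X : SimpleGraph V) [TDLC.IsCayleyAbelsGraph G X] (x₀ : V) :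
    TDLC.IsUniformConvergenceAction G (TDLC.GromovBoundary X x₀) := by
  obtain ⟨δ, hδ⟩ := hG.exists_fourPoint X
  have hX : X.Connected := TDLC.IsCayleyAbelsGraph.connected G
  have hfin : ∀ a, (X.neighborSet a).Finite := TDLC.IsCayleyAbelsGraph.finite_neighborSet G
  exact
    { compactSpace := TDLC.GromovBoundary.compactSpace hX hfin hδ
      t2Space := TDLC.GromovBoundary.t2Space hX hfin hδ
      continuousSMul := TDLC.GromovBoundary.continuousSMul hδ
      isProperAction := TDLC.isProperAction_distinctTriples hδ
      isCocompactAction := TDLC.isCocompactAction_distinctTriples hδ }
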